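/- Fix an integer $r\ge 3$; throughout, $n$ runs over multiples of $r$, limits and $o(\cdot)$ are as $n\to\infty$, and "w.h.p." means with probability tending to $1$. An $r$-graph on $[n]=\{1,\dots,n\}$ is a subset of $\mathcal K=\binom{[n]}{r}$; $d_{\mathcal H}(x)$ is the number of edges of $\mathcal H$ containing $x$, and $\Phi(\mathcal H)$ is the number of perfect matchings of $\mathcal H$ (sets of $n/r$ pairwise disjoint edges). Let $\mathbf H_{n,M}$ be uniform among the $r$-graphs on $[n]$ with exactly $M$ edges. Let $A_1,A_2,\dots$ be a uniformly random ordering of $\mathcal K$, $\mathbf H_t=\{A_1,\dots,A_t\}$, and $T=\min\{t: A_1\cup\dots\cup A_t=[n]\}$. For $\varepsilon>0$ let $Z(\varepsilon)$ be the following statement. For every $\varsigma=\varsigma(n)\to0$ there is $\varrho=\varrho(n)\to0$ such that for all sufficiently large $n$, for all integers $M\ge 0$ and $\delta_x\ge 0$ $(x\in[n])$ with $|M-\frac nr\log n|\le\varsigma\,\frac nr\log n$ and $|\delta_x-\varepsilon\log n|\le\varsigma\,\varepsilon\log n$ for all $x$, $$\Pr\Big(\Phi(\mathbf H_{n,M})\le\big[e^{-(r-1)}\log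 n\big]^{n/r}e^{-\varrho n}\ \Big|\ d_{\mathbf H_{n,M}}(x)\ge\delta_x\ \ \forall x\in[n]\Big)<\varrho .$$ Theorem. There is $\varepsilon_0>0$ (depending only on $r$) such that for every $\varepsilon\in(0,\varepsilon_0)$, $Z(\varepsilon)$ implies both of the following: (i) there is $\varrho=\varrho(n)\to 0$ such that w.h.p. $\Phi(\mathbf H_T)>\big[e^{-(r-1)}\log n\big]^{n/r}e^{-\varrho n}$; (ii) w.h.p. $\mathbf H_T$ has a perfect matching. -/

import Mathlib

open Filter Topology

namespace Shamir

/-- The set `𝒦` of all `r`-subsets of the vertex set `V = [n]` (realised as `Fin n`). -/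
abbrev Edge (n r : ℕ) : Type := {A : Finset (Fin n) // A.card = r}

/-- An `r`-graph on `[n]`: a set of `r`-subsets of `[n]`. -/
abbrev RGraph (n r : ℕ) : Type := Finset (Edge n r)

/-- The degree of the vertex `x` in `H`. -/
def degree {n r : ℕ} (H : RGraph n r) (x : Fin n) : ℕ :=
  (H.filter (fun A => x ∈ A.1)).card

/-- `m` is a perfect matching of `H`: a set of pairwise disjoint edges of `H`, of size `n / r`
(written as `|m| * r = n`). -/
def IsPerfectMatching {n r : ℕ} (H m : RGraph n r) : Prop :=
  m ⊆ H ∧ (∀ A ∈ m, ∀ B ∈ m, A ≠ B → Disjoint A.1 B.1) ∧ m.card * r = n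

open Classical in
/-- `Φ(H)`, the number of perfect matchings of `H`. -/
noncomputable def numPM {n r : ℕ} (H : RGraph n r) : ℕ :=
  (Finset.univ.filter (fun m : RGraph n r => IsPerfectMatching H m)).card

open Classical in
/-- The probability that `p` holds for a uniformly random element of the finite set `S`. -/
noncomputable def unifProb {Ω : Type} (S : Finset Ω) (p : Ω → Prop) : ℝ :=
  ((S.filter p).card : ℝ) / (S.card : ℝ)

/-- The conditional probability of `p` given `q`, for a uniformly random element of `S`. -/
noncomputable def unifCondProb {Ω : Type} (S : Finset Ω) (p q : Ω → Prop) : ℝ :=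
  unifProb S (fun ω => p ω ∧ q ω) / unifProb S q

/-- The `r`-graphs on `[n]` with exactly `M` edges; the random `r`-graph `H_{n,M}` is a uniformly
random element of this set. -/
def graphsWithEdges (n r M : ℕ) : Finset (RGraph n r) :=
  Finset.powersetCard M (Finset.univ : Finset (Edge n r))

/-- The limit `n → ∞` through the multiples of `r`. -/
def atTopMultiples (r : ℕ) : Filter ℕ := atTop ⊓ 𝓟 {n : ℕ | r ∣ n}

/-- The number `[e^{-(r-1)} log n]^{n/r} e^{-ϱ n}`; it is used for `n` a multiple of `r` only, so
that the division in the exponent `n / r` is exact. -/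
noncomputable def pmBound (r n : ℕ) (ϱ : ℝ) : ℝ :=
  (Real.exp (-((r : ℝ) - 1)) * Real.log n) ^ (n / r) * Real.exp (-(ϱ * n))

/-- The conditional counting statement for given `r` and `ε`: for each `ς = o(1)` there is
`ϱ = o(1)` such that for all large multiples `n` of `r`, if `M = (1 ± ς)(n/r) log n` and
`δ x = (1 ± ς) ε log n` for every vertex `x`, then `H_{n,M}`, conditioned on
`d(x) ≥ δ x` for all `x`, has at most `[e^{-(r-1)} log n]^{n/r} e^{-ϱ n}` perfect matchings with
probability less than `ϱ`. -/
def ConditionalCounting (r : ℕ) (ε : ℝ) : Prop :=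
  ∀ ς : ℕ → ℝ, Tendsto ς atTop (𝓝 0) →
    ∃ ϱ : ℕ → ℝ, Tendsto ϱ atTop (𝓝 0) ∧
      ∀ᶠ n in atTopMultiples r, ∀ (M : ℕ) (δ : Fin n → ℕ),
        |(M : ℝ) - (n : ℝ) / r * Real.log n| ≤ ς n * ((n : ℝ) / r * Real.log n) →
        (∀ x, |(δ x : ℝ) - ε * Real.log n| ≤ ς n * (ε * Real.log n)) →
        unifCondProb (graphsWithEdges n r M)
          (fun H => (numPM H : ℝ) ≤ pmBound r n (ϱ n))
          (fun H => ∀ x, δ x ≤ degree H x) < ϱ n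

/-- An ordering `A_1, A_2, …` of `𝒦`; here `A_{i+1}` is `a i`. -/
abbrev EdgeOrdering (n r : ℕ) : Type := Fin (n.choose r) ≃ Edge n r

/-- `H_t = {A_1, …, A_t}`. -/
def graphAt {n r : ℕ} (a : EdgeOrdering n r) (t : ℕ) : RGraph n r :=
  Finset.univ.filter (fun A => (a.symm A : ℕ) < t)

/-- The hitting time `T = min {t : A_1 ∪ ⋯ ∪ A_t = V}`. -/
noncomputable def hittingTime {n r : ℕ} (a : EdgeOrdering n r) : ℕ :=
  sInf {t : ℕ | ∀ v : Fin n, ∃ A ∈ graphAt a t, v ∈ A.1}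

/-- The counting version of the hitting time statement: for some `ϱ = o(1)`, w.h.p. `H_T` has
more than `[e^{-(r-1)} log n]^{n/r} e^{-ϱ n}` perfect matchings. -/
def HittingTimeCounting (r : ℕ) : Prop :=
  ∃ ϱ : ℕ → ℝ, Tendsto ϱ atTop (𝓝 0) ∧
    Tendsto
      (fun n => unifProb (Finset.univ : Finset (EdgeOrdering n r))
        (fun a => pmBound r n (ϱ n) < (numPM (graphAt a (hittingTime a)) : ℝ)))
      (atTopMultiples r) (𝓝 1)

/-- The hitting time statement: w.h.p. `H_T` has a perfect matching. -/
def HittingTimePM (r : ℕ) : Prop :=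
  Tendsto
    (fun n => unifProb (Finset.univ : Finset (EdgeOrdering n r))
      (fun a => ∃ m, IsPerfectMatching (graphAt a (hittingTime a)) m))
    (atTopMultiples r) (𝓝 1)

end Shamir

/-!
At a time `M₀` slightly before the hitting time `T`, namely `M₀ ≈ (n / r) (log n - √(log n))`, let
the vertices of low degree be those of degree less than `ε log n`. For small `ε` there are at most
`√n` of them, and with high probability they are far apart in the graph: the first edges (in the
ordering) through these vertices are pairwise disjoint, no edge of `H_{M₀}` meets two of them, and
a vertex outside their union `U` (the absorbed set) lies in at most one edge of `H_{M₀}` which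
meets `U`. See `IsSparse` and `tendsto_unifProb_not_isSparse`.

Fix `U` and the positions of all edges meeting `U`. A permutation of the remaining edges changes
neither of these as long as the vertices outside `U` keep degree at least `ε log n`; so the graph
which `H_{M₀}` induces outside `U` is uniform among the graphs with a given number of edges whose
degrees exceed given bounds, all close to `ε log n` (`absorbed_eq_and_agree_iff`,
`exists_card_agree_eq`). This is the random graph of the conditional counting hypothesis, on
`n - k r ≥ n - r √n` vertices, so it has many perfect matchings. Since `M₀ ≤ T`, and since the
first edge of every vertex belongs to `H_T`, adding the `k` first edges that make up `U` turns each
of them into a perfect matching of `H_T` (`numPM_inducedAt_le`); replacing `n` by `n - k r` costs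
only a factor `exp (o(n))` in the count (`pmBound_le_pmBound`). All of this is collected in
`unifProb_sparse_few_PM_le`.

The probabilistic estimates rest on an exchange argument for random orderings
(`card_position_mem`), which places the relevant edges one at a time. It gives the exponential
moment bound `unifProb_few_and_before_le`, hence `unifProb_low_le`: the events that one or two
given vertices have low degree and that given edges appear early behave as if independent. Union
bounds over chains and forks of edges near the vertices of low degree then give sparsity. Finally,
`M₀ ≤ T` with high probability because the second moment method yields an isolated vertex at time
`M₀` (`le_unifProb_exists_isolated`).
-/

namespace Shamir

/-! ### Probabilities under the uniform distribution -/

section Prob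

variable {Ω : Type}

theorem unifProb_eq (S : Finset Ω) (p : Ω → Prop) [DecidablePred p] :
    unifProb S p = ((S.filter p).card : ℝ) / (S.card : ℝ) := by
  unfold unifProb
  congr!

theorem unifProb_nonneg (S : Finset Ω) (p : Ω → Prop) : 0 ≤ unifProb S p := by
  unfold unifProb; positivity

theorem unifProb_le_one (S : Finset Ω) (p : Ω → Prop) : unifProb S p ≤ 1 := by
  classical
  unfold unifProb
  refine div_le_one_of_le₀ ?_ (by positivity)
  exact_mod_cast Finset.card_filter_le _ _

theorem unifProb_mono (S : Finset Ω) {p q : Ω → Prop} (h : ∀ ω ∈ S, p ω → q ω) :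
    unifProb S p ≤ unifProb S q := by
  classical
  unfold unifProb
  gcongr with ω hω
  exact h ω hω

theorem unifProb_or_le (S : Finset Ω) (p q : Ω → Prop) :
    unifProb S (fun ω => p ω ∨ q ω) ≤ unifProb S p + unifProb S q := by
  classical
  rw [unifProb_eq, unifProb_eq, unifProb_eq, ← add_div]
  gcongr
  rw [Finset.filter_or]
  exact_mod_cast Finset.card_union_le _ _

theorem unifProb_exists_le {ι : Type*} (S : Finset Ω) (s : Finset ι) (p : ι → Ω → Prop) :
    unifProb S (fun ω => ∃ i ∈ s, p i ω) ≤ ∑ i ∈ s, unifProb S (p i) := by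
  classical
  simp only [unifProb_eq]
  rw [← Finset.sum_div]
  gcongr
  have : S.filter (fun ω => ∃ i ∈ s, p i ω) = s.biUnion (fun i => S.filter (p i)) := by
    ext; simp; tauto
  rw [this]
  exact_mod_cast Finset.card_biUnion_le

theorem unifProb_exists_le_card_mul {ι : Type*} (S : Finset Ω) (s : Finset ι)
    (p : ι → Ω → Prop) {c : ℝ} (h : ∀ i ∈ s, unifProb S (p i) ≤ c) :
    unifProb S (fun ω => ∃ i ∈ s, p i ω) ≤ s.card * c := by
  refine (unifProb_exists_le S s p).trans ?_
  rw [← nsmul_eq_mul]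
  exact Finset.sum_le_card_nsmul _ _ _ h

theorem unifProb_add_not {S : Finset Ω} (hS : S.Nonempty) (p : Ω → Prop) :
    unifProb S p + unifProb S (fun ω => ¬ p ω) = 1 := by
  classical
  have h : (S.card : ℝ) ≠ 0 := by exact_mod_cast hS.card_pos.ne'
  rw [unifProb_eq, unifProb_eq, ← add_div, div_eq_one_iff_eq h]
  exact_mod_cast Finset.card_filter_add_card_filter_not (s := S) p

/-- Markov's inequality for the size of a random finite set, in terms of the expected size. -/
theorem unifProb_card_filter_gt_le {ι : Type*} (S : Finset Ω) (s : Finset ι)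
    (p : ι → Ω → Prop) [∀ i ω, Decidable (p i ω)] {t : ℝ} (ht : 0 < t) :
    unifProb S (fun ω => t < (s.filter (fun i => p i ω)).card)
      ≤ (∑ i ∈ s, unifProb S (p i)) / t := by
  classical
  simp only [unifProb_eq]
  rw [← Finset.sum_div, div_right_comm]
  gcongr
  rw [le_div_iff₀ ht]
  have h1 : ∑ i ∈ s, ((S.filter (p i)).card : ℝ)
      = ∑ ω ∈ S, ((s.filter (fun i => p i ω)).card : ℝ) := by
    norm_cast
    simp only [Finset.card_filter]
    rw [Finset.sum_comm]
  rw [h1, ← nsmul_eq_mul]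
  calc _ ≤ ∑ ω ∈ S.filter (fun ω => t < (s.filter (fun i => p i ω)).card),
        ((s.filter (fun i => p i ω)).card : ℝ) := by
        refine Finset.card_nsmul_le_sum _ _ _ fun ω hω => ?_
        exact (Finset.mem_filter.1 hω).2.le
    _ ≤ _ := Finset.sum_le_sum_of_subset_of_nonneg (Finset.filter_subset _ _)
        fun _ _ _ => by positivity

/-- The second moment bound: if `X` counts the indices `i ∈ s` for which `p i` holds, then
`(𝔼 X)² ≤ 𝔼 X² · Pr(X > 0)`. -/
theorem sq_sum_unifProb_le {ι : Type*} (S : Finset Ω) (s : Finset ι) (p : ι → Ω → Prop) :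
    (∑ i ∈ s, unifProb S (p i)) ^ 2
      ≤ (∑ i ∈ s, ∑ j ∈ s, unifProb S (fun ω => p i ω ∧ p j ω))
        * unifProb S (fun ω => ∃ i ∈ s, p i ω) := by
  classical
  simp only [unifProb_eq, ← Finset.sum_div]
  rw [div_mul_div_comm, div_pow, ← sq]
  gcongr
  have hc : ∀ (q : Ω → Prop) [DecidablePred q], ((S.filter q).card : ℝ) = ∑ ω ∈ S, if q ω then 1 else 0 := by
    intro q _; rw [Finset.card_filter]; push_cast; rfl
  have h1 : ∑ i ∈ s, ((S.filter (p i)).card : ℝ)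
      = ∑ ω ∈ S, (∑ i ∈ s, if p i ω then (1 : ℝ) else 0) * (if ∃ i ∈ s, p i ω then 1 else 0) := by
    simp only [hc]
    rw [Finset.sum_comm]
    refine Finset.sum_congr rfl fun ω _ => ?_
    split_ifs with h
    · simp
    · push Not at h
      rw [mul_zero]
      exact Finset.sum_eq_zero fun i hi => if_neg (h i hi)
  have h2 : ∑ i ∈ s, ∑ j ∈ s, ((S.filter (fun ω => p i ω ∧ p j ω)).card : ℝ)
      = ∑ ω ∈ S, (∑ i ∈ s, if p i ω then (1 : ℝ) else 0) ^ 2 := by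
    simp only [hc, sq, Finset.sum_mul_sum]
    simp_rw [Finset.sum_comm (s := s) (t := S)]
    refine Finset.sum_congr rfl fun ω _ => Finset.sum_congr rfl fun i _ =>
      Finset.sum_congr rfl fun j _ => ?_
    by_cases h : p i ω <;> by_cases h' : p j ω <;> simp [h, h']
  have h3 : ((S.filter (fun ω => ∃ i ∈ s, p i ω)).card : ℝ)
      = ∑ ω ∈ S, (if ∃ i ∈ s, p i ω then (1 : ℝ) else 0) ^ 2 := by
    rw [hc]; simp
  rw [h1, h2, h3]
  exact Finset.sum_mul_sq_le_sq_mul_sq _ _ _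

end Prob

/-! ### Positions in a random ordering -/

section Orderings

variable {ι α : Type} [Fintype ι] [DecidableEq ι] [Fintype α] [DecidableEq α]

/-- Exchange argument: transposing the position of `e` with a position not occupied by `Z` does
not affect an event `Q` that is determined by the positions of `Z`. -/
theorem card_position_mem (Q : (ι ≃ α) → Prop) [DecidablePred Q] (Z : Finset α) {e : α}
    (he : e ∉ Z) (B : Finset ι)
    (hQ : ∀ a b : ι ≃ α, (∀ z ∈ Z, a.symm z = b.symm z) → Q a → Q b) :
    ∑ a : ι ≃ α with Q a ∧ a.symm e ∈ B, ((Z.image a.symm)ᶜ).card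
      = ∑ a : ι ≃ α with Q a, (B \ Z.image a.symm).card := by
  rw [← Finset.card_sigma, ← Finset.card_sigma]
  have key : ∀ (a : ι ≃ α) (i : ι), i ∉ Z.image a.symm →
      ∀ z ∈ Z, ((Equiv.swap i (a.symm e)).trans a).symm z = a.symm z := by
    intro a i hi z hz
    simp only [Equiv.symm_trans_apply, Equiv.symm_swap]
    refine Equiv.swap_apply_of_ne_of_ne ?_ ?_
    · rintro rfl; exact hi (Finset.mem_image_of_mem _ hz)
    · intro h; exact he (a.symm.injective h ▸ hz)
  have key2 : ∀ (a : ι ≃ α) (i : ι), i ∉ Z.image a.symm →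
      Z.image ((Equiv.swap i (a.symm e)).trans a).symm = Z.image a.symm := by
    intro a i hi
    exact Finset.image_congr fun z hz => key a i hi z hz
  have he' : ∀ (a : ι ≃ α), a.symm e ∉ Z.image a.symm := by
    intro a h
    obtain ⟨z, hz, h⟩ := Finset.mem_image.1 h
    exact he (a.symm.injective h ▸ hz)
  -- a pair `(a, i)` goes to the ordering with `e` at `i`, together with the old position of `e`
  let F : (Σ _ : ι ≃ α, ι) → (Σ _ : ι ≃ α, ι) :=
    fun x => ⟨(Equiv.swap x.2 (x.1.symm e)).trans x.1, x.1.symm e⟩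
  have hF : ∀ x, F (F x) = x := by
    rintro ⟨a, i⟩
    simp only [F, Equiv.symm_trans_apply, Equiv.symm_swap, Equiv.swap_apply_right]
    congr 1
    ext j
    simp [Equiv.swap_comm]
  refine Finset.card_nbij' F F ?_ ?_ (fun x _ => hF x) (fun x _ => hF x)
  · rintro ⟨a, i⟩ h
    simp only [Finset.coe_sigma, Set.mem_sigma_iff, Finset.coe_filter, Set.mem_ofPred_eq,
      Finset.mem_univ, true_and, Finset.mem_coe, Finset.mem_compl] at h
    obtain ⟨⟨hq, hB⟩, hi⟩ := h
    simp only [F, Finset.coe_sigma, Set.mem_sigma_iff, Finset.coe_filter, Set.mem_ofPred_eq,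
      Finset.mem_univ, true_and, Finset.mem_coe, Finset.mem_sdiff, key2 a i hi]
    exact ⟨hQ a _ (fun z hz => (key a i hi z hz).symm) hq, hB, he' a⟩
  · rintro ⟨a, i⟩ h
    simp only [Finset.coe_sigma, Set.mem_sigma_iff, Finset.coe_filter, Set.mem_ofPred_eq,
      Finset.mem_univ, true_and, Finset.mem_coe, Finset.mem_sdiff] at h
    obtain ⟨hq, hB, hi⟩ := h
    simp only [F, Finset.coe_sigma, Set.mem_sigma_iff, Finset.coe_filter, Set.mem_ofPred_eq,
      Finset.mem_univ, true_and, Finset.mem_coe, Finset.mem_compl, key2 a i hi]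
    refine ⟨⟨hQ a _ (fun z hz => (key a i hi z hz).symm) hq, ?_⟩, he' a⟩
    simpa using hB

/-- Given an event `Q` determined by the positions of `Z`, the element `e` is placed in `B` with
probability at most `m / (|ι| - |Z|)` if `Z` leaves at most `m` positions of `B` free. -/
theorem unifProb_position_mem_le (Q : (ι ≃ α) → Prop) (Z : Finset α) {e : α}
    (he : e ∉ Z) (B : Finset ι) (m : ℕ)
    (hQ : ∀ a b : ι ≃ α, (∀ z ∈ Z, a.symm z = b.symm z) → Q a → Q b)
    (hm : ∀ a : ι ≃ α, Q a → (B \ Z.image a.symm).card ≤ m) :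
    unifProb Finset.univ (fun a : ι ≃ α => Q a ∧ a.symm e ∈ B)
        * ((Fintype.card ι : ℝ) - Z.card)
      ≤ unifProb Finset.univ Q * m := by
  classical
  have h := card_position_mem Q Z he B hQ
  have h1 : ∀ a : ι ≃ α, (((Z.image a.symm)ᶜ).card : ℝ) = (Fintype.card ι : ℝ) - Z.card := by
    intro a
    rw [Finset.card_compl, Finset.card_image_of_injective _ a.symm.injective, Nat.cast_sub]
    rw [← Finset.card_image_of_injective Z a.symm.injective]
    exact Finset.card_le_univ _
  have h2 : ((Finset.univ.filter (fun a : ι ≃ α => Q a ∧ a.symm e ∈ B)).card : ℝ)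
      * ((Fintype.card ι : ℝ) - Z.card) ≤ (Finset.univ.filter Q).card * m := by
    have h3 : (∑ a : ι ≃ α with Q a ∧ a.symm e ∈ B, (((Z.image a.symm)ᶜ).card : ℝ))
        = ∑ a : ι ≃ α with Q a, ((B \ Z.image a.symm).card : ℝ) := by exact_mod_cast h
    simp only [h1, Finset.sum_const, nsmul_eq_mul] at h3
    rw [h3, ← nsmul_eq_mul]
    refine Finset.sum_le_card_nsmul _ _ _ fun a ha => ?_
    exact_mod_cast hm a (Finset.mem_filter.1 ha).2
  rw [unifProb_eq, unifProb_eq, div_mul_eq_mul_div, div_mul_eq_mul_div]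
  exact div_le_div_of_nonneg_right h2 (by positivity)

theorem unifProb_position_mem_eq (Q : (ι ≃ α) → Prop) (Z : Finset α) {e : α}
    (he : e ∉ Z) (B : Finset ι) (m : ℕ)
    (hQ : ∀ a b : ι ≃ α, (∀ z ∈ Z, a.symm z = b.symm z) → Q a → Q b)
    (hm : ∀ a : ι ≃ α, Q a → (B \ Z.image a.symm).card = m) :
    unifProb Finset.univ (fun a : ι ≃ α => Q a ∧ a.symm e ∈ B)
        * ((Fintype.card ι : ℝ) - Z.card)
      = unifProb Finset.univ Q * m := by
  classical
  have h := card_position_mem Q Z he B hQ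
  have h1 : ∀ a : ι ≃ α, (((Z.image a.symm)ᶜ).card : ℝ) = (Fintype.card ι : ℝ) - Z.card := by
    intro a
    rw [Finset.card_compl, Finset.card_image_of_injective _ a.symm.injective, Nat.cast_sub]
    rw [← Finset.card_image_of_injective Z a.symm.injective]
    exact Finset.card_le_univ _
  have h2 : ((Finset.univ.filter (fun a : ι ≃ α => Q a ∧ a.symm e ∈ B)).card : ℝ)
      * ((Fintype.card ι : ℝ) - Z.card) = (Finset.univ.filter Q).card * m := by
    have h3 : (∑ a : ι ≃ α with Q a ∧ a.symm e ∈ B, (((Z.image a.symm)ᶜ).card : ℝ))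
        = ∑ a : ι ≃ α with Q a, ((B \ Z.image a.symm).card : ℝ) := by exact_mod_cast h
    simp only [h1, Finset.sum_const, nsmul_eq_mul] at h3
    rw [h3, ← nsmul_eq_mul]
    refine Finset.sum_eq_card_nsmul fun a ha => ?_
    exact_mod_cast hm a (Finset.mem_filter.1 ha).2
  rw [unifProb_eq, unifProb_eq, div_mul_eq_mul_div, div_mul_eq_mul_div, h2]

end Orderings

section FinOrderings

variable {α : Type} [Fintype α] [DecidableEq α] {N : ℕ}

/-- The probability that none of the elements of `Z` is among the first `M`. -/
theorem unifProb_avoid_eq [Nonempty (Fin N ≃ α)] (M : ℕ) (Z : Finset α)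
    (hZ : Z.card + M ≤ N) :
    unifProb Finset.univ (fun a : Fin N ≃ α => ∀ e ∈ Z, M ≤ (a.symm e : ℕ))
      = ∏ i ∈ Finset.range Z.card, (((N : ℝ) - M - i) / (N - i)) := by
  classical
  induction Z using Finset.induction_on with
  | empty =>
    unfold unifProb
    simp
  | insert e Z he ih =>
    rw [Finset.card_insert_of_notMem he] at hZ ⊢
    rw [Finset.prod_range_succ, ← ih (by omega)]
    have h := unifProb_position_mem_eq (ι := Fin N) (α := α)
      (fun a => ∀ e ∈ Z, M ≤ (a.symm e : ℕ)) Z he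
      (Finset.univ.filter (fun i : Fin N => M ≤ (i : ℕ))) (N - M - Z.card)
      (fun a b hab ha z hz => hab z hz ▸ ha z hz) ?_
    · rw [Fintype.card_fin] at h
      have hne : (N : ℝ) - Z.card ≠ 0 := by
        have : (Z.card : ℝ) + 1 + M ≤ N := by exact_mod_cast hZ
        have : (0 : ℝ) ≤ M := by positivity
        linarith
      rw [← mul_div_assoc, eq_div_iff hne]
      have hc : ((N - M - Z.card : ℕ) : ℝ) = (N : ℝ) - M - Z.card := by
        rw [Nat.cast_sub (by omega), Nat.cast_sub (by omega)]
      rw [hc] at h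
      rw [← h]
      congr 2
      funext a
      simp [and_comm]
    · intro a ha
      rw [Finset.card_sdiff_of_subset, Finset.card_image_of_injective _ a.symm.injective]
      · congr 1
        have h1 := Fin.card_filter_val_lt (n := N) (m := M)
        have h2 := Finset.card_filter_add_card_filter_not (s := (Finset.univ : Finset (Fin N)))
          (fun i => (i : ℕ) < M)
        simp only [not_lt, Finset.card_univ, Fintype.card_fin] at h2
        omega
      · intro i hi
        obtain ⟨z, hz, rfl⟩ := Finset.mem_image.1 hi
        simpa using ha z hz

/-- Each element of `F` comes among the first `M` with conditional probability at most
`M / (N - |Z| - |F|)`, given an event determined by the positions of `Z`. -/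
theorem unifProb_and_before_le (M : ℕ) (Q : (Fin N ≃ α) → Prop) (Z F : Finset α)
    (hdisj : Disjoint Z F) (hN : Z.card + F.card < N)
    (hQ : ∀ a b : Fin N ≃ α, (∀ z ∈ Z, a.symm z = b.symm z) → Q a → Q b) :
    ∀ k, Z.card + F.card ≤ k → k < N →
    unifProb Finset.univ (fun a : Fin N ≃ α => Q a ∧ ∀ e ∈ F, (a.symm e : ℕ) < M)
      ≤ unifProb Finset.univ Q * ((M : ℝ) / (N - k)) ^ F.card := by
  classical
  intro k
  induction F using Finset.induction_on with
  | empty => simp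
  | insert e F he ih =>
    rw [Finset.card_insert_of_notMem he] at hN ⊢
    intro hk hkN
    rw [Finset.disjoint_insert_right] at hdisj
    have ih := ih hdisj.2 (by omega) (by omega) hkN
    have h := unifProb_position_mem_le (ι := Fin N) (α := α)
      (fun a => Q a ∧ ∀ e ∈ F, (a.symm e : ℕ) < M) (Z ∪ F) (e := e)
      (by simp [he, hdisj.1])
      (Finset.univ.filter (fun i : Fin N => (i : ℕ) < M)) M
      (fun a b hab ha => ⟨hQ a b (fun z hz => hab z (Finset.mem_union_left _ hz)) ha.1,
        fun z hz => hab z (Finset.mem_union_right _ hz) ▸ ha.2 z hz⟩) ?_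
    · rw [Fintype.card_fin] at h
      have hkN' : (0 : ℝ) < (N : ℝ) - k := by
        rw [sub_pos]; exact_mod_cast hkN
      have hle : (N : ℝ) - k ≤ N - (Z ∪ F).card := by
        have : (Z ∪ F).card ≤ k := (Finset.card_union_le _ _).trans (by omega)
        have : ((Z ∪ F).card : ℝ) ≤ k := by exact_mod_cast this
        linarith
      have heq : unifProb Finset.univ
          (fun a : Fin N ≃ α => Q a ∧ ∀ e' ∈ insert e F, (a.symm e' : ℕ) < M)
          = unifProb Finset.univ (fun a : Fin N ≃ α => (Q a ∧ ∀ e ∈ F, (a.symm e : ℕ) < M) ∧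
            a.symm e ∈ Finset.univ.filter (fun i : Fin N => (i : ℕ) < M)) := by
        congr 1
        funext a
        simp
        tauto
      rw [heq, pow_succ, ← mul_assoc, ← mul_div_assoc, le_div_iff₀ hkN']
      calc _ ≤ _ := mul_le_mul_of_nonneg_left hle (unifProb_nonneg _ _)
        _ ≤ _ := h
        _ ≤ _ := mul_le_mul_of_nonneg_right ih (by positivity)
    · intro a ha
      refine (Finset.card_le_card Finset.sdiff_subset).trans ?_
      rw [← Finset.card_range M]
      refine Finset.card_le_card_of_injOn (fun i => (i : ℕ)) ?_ ?_
      · intro i hi; simpa using hi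
      · intro i _ j _ h; exact Fin.ext h

theorem prod_avoid_le (N M z : ℕ) (hZ : z + M ≤ N) :
    ∏ i ∈ Finset.range z, (((N : ℝ) - M - i) / (N - i)) ≤ (1 - (M : ℝ) / N) ^ z := by
  have hc : (z : ℝ) + M ≤ N := by exact_mod_cast hZ
  have hM : (0 : ℝ) ≤ M := by positivity
  calc _ ≤ ∏ i ∈ Finset.range z, (1 - (M : ℝ) / N) := by
        refine Finset.prod_le_prod (fun i hi => ?_) fun i hi => ?_
        · have : (i : ℝ) + 1 ≤ z := by exact_mod_cast Finset.mem_range.1 hi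
          exact div_nonneg (by linarith) (by linarith)
        · have : (i : ℝ) + 1 ≤ z := by exact_mod_cast Finset.mem_range.1 hi
          have hi0 : (0 : ℝ) ≤ i := by positivity
          have h1 : (0 : ℝ) < N - i := by linarith
          have h2 : (0 : ℝ) < N := by linarith
          rw [div_le_iff₀ h1, ← sub_nonneg]
          have : (1 - (M : ℝ) / N) * (N - i) - (N - M - i) = M * i / N := by field_simp; ring
          rw [this]; positivity
    _ = _ := by simp

/-- Few of the elements of `Z` are among the first `M₀`, and all of those of `F` are among the
first `M₁`. The bound is obtained from the exponential moment with parameter `ρ`, summing over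
the set `S` of the elements of `Z` which come before `M₀`. -/
theorem unifProb_few_and_before_le [Nonempty (Fin N ≃ α)] (M₀ M₁ s k : ℕ) (Z F : Finset α)
    (hdisj : Disjoint Z F) (hM : Z.card + M₀ ≤ N) (hk : Z.card + F.card ≤ k) (hkN : k < N)
    {ρ : ℝ} (hρ : 0 < ρ) (hρ1 : ρ ≤ 1) :
    unifProb Finset.univ (fun a : Fin N ≃ α =>
        (Z.filter (fun e => (a.symm e : ℕ) < M₀)).card ≤ s ∧ ∀ e ∈ F, (a.symm e : ℕ) < M₁)
      ≤ (ρ ^ s)⁻¹ * ((M₁ : ℝ) / (N - k)) ^ F.card *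
        (1 - (M₀ : ℝ) / N + ρ * (M₀ / (N - k))) ^ Z.card := by
  classical
  have hkN' : (0 : ℝ) < (N : ℝ) - k := by
    rw [sub_pos]; exact_mod_cast hkN
  have hM' : (0 : ℝ) ≤ 1 - (M₀ : ℝ) / N := by
    rw [sub_nonneg]
    refine div_le_one_of_le₀ ?_ (by positivity)
    exact_mod_cast (by omega : M₀ ≤ N)
  set q := 1 - (M₀ : ℝ) / N
  set q₁ := (M₁ : ℝ) / (N - k)
  set q₀ := (M₀ : ℝ) / (N - k)
  have hq₁ : 0 ≤ q₁ := by positivity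
  have hq₀ : 0 ≤ q₀ := by positivity
  have step : ∀ S ∈ Z.powerset.filter (fun S => S.card ≤ s),
      unifProb Finset.univ (fun a : Fin N ≃ α => ((∀ e ∈ Z \ S, M₀ ≤ (a.symm e : ℕ)) ∧
        ∀ e ∈ S, (a.symm e : ℕ) < M₀) ∧ ∀ e ∈ F, (a.symm e : ℕ) < M₁)
      ≤ (ρ ^ s)⁻¹ * q₁ ^ F.card * ((ρ * q₀) ^ S.card * q ^ (Z.card - S.card)) := by
    intro S hS
    rw [Finset.mem_filter, Finset.mem_powerset] at hS
    obtain ⟨hSZ, hSs⟩ := hS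
    have hcard : (Z \ S).card + S.card = Z.card := Finset.card_sdiff_add_card_eq_card hSZ
    have h1 := unifProb_and_before_le M₁ (N := N) (α := α)
      (fun a => (∀ e ∈ Z \ S, M₀ ≤ (a.symm e : ℕ)) ∧ ∀ e ∈ S, (a.symm e : ℕ) < M₀) Z F
      hdisj (by omega) (fun a b hab ha => ⟨fun z hz => hab z (Finset.mem_sdiff.1 hz).1 ▸ ha.1 z hz,
        fun z hz => hab z (hSZ hz) ▸ ha.2 z hz⟩) k hk hkN
    have h2 := unifProb_and_before_le M₀ (N := N) (α := α)
      (fun a => (∀ e ∈ Z \ S, M₀ ≤ (a.symm e : ℕ))) (Z \ S) S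
      Finset.sdiff_disjoint (by omega) (fun a b hab ha z hz => hab z hz ▸ ha z hz) k
      (by omega) hkN
    have h3 := unifProb_avoid_eq (N := N) (α := α) M₀ (Z \ S) (by omega)
    have h4 := prod_avoid_le N M₀ (Z \ S).card (by omega)
    rw [← h3] at h4
    have hZS : (Z \ S).card = Z.card - S.card := by omega
    have hρs : 1 ≤ (ρ ^ s)⁻¹ * ρ ^ S.card := by
      rw [inv_mul_eq_div, one_le_div (by positivity)]
      exact pow_le_pow_of_le_one hρ.le hρ1 hSs
    calc _ ≤ _ := h1
      _ ≤ q ^ (Z.card - S.card) * q₀ ^ S.card * q₁ ^ F.card := by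
          gcongr
          refine h2.trans ?_
          gcongr
          rw [← hZS]; exact h4
      _ ≤ ((ρ ^ s)⁻¹ * ρ ^ S.card) * (q ^ (Z.card - S.card) * q₀ ^ S.card * q₁ ^ F.card) :=
          le_mul_of_one_le_left (by positivity) hρs
      _ = _ := by rw [mul_pow]; ring
  calc _ ≤ unifProb Finset.univ (fun a : Fin N ≃ α => ∃ S ∈ Z.powerset.filter (fun S => S.card ≤ s),
        ((∀ e ∈ Z \ S, M₀ ≤ (a.symm e : ℕ)) ∧
        ∀ e ∈ S, (a.symm e : ℕ) < M₀) ∧ ∀ e ∈ F, (a.symm e : ℕ) < M₁) := by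
        refine unifProb_mono _ fun a _ ha =>
          ⟨Z.filter (fun e => (a.symm e : ℕ) < M₀), ?_, ⟨?_, ?_⟩, ha.2⟩
        · simp [ha.1]
        · intro e he
          simp only [Finset.mem_sdiff, Finset.mem_filter, not_and, not_lt] at he
          exact he.2 he.1
        · intro e he
          exact (Finset.mem_filter.1 he).2
    _ ≤ _ := unifProb_exists_le _ _ _
    _ ≤ _ := Finset.sum_le_sum step
    _ ≤ ∑ S ∈ Z.powerset,
          (ρ ^ s)⁻¹ * q₁ ^ F.card * ((ρ * q₀) ^ S.card * q ^ (Z.card - S.card)) :=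
        Finset.sum_le_sum_of_subset_of_nonneg (Finset.filter_subset _ _)
          fun _ _ _ => by positivity
    _ = _ := by
        rw [← Finset.mul_sum, Finset.sum_pow_mul_eq_add_pow, add_comm]

end FinOrderings

/-! ### Counting edges and chains of edges -/

section Counting

variable {n r : ℕ}

/-- The set of all `r`-subsets of `[n]` which contain the vertex `x`. -/
def star (r : ℕ) (x : Fin n) : RGraph n r := Finset.univ.filter (fun A => x ∈ A.1)

@[simp] theorem mem_star {x : Fin n} {A : Edge n r} : A ∈ star r x ↔ x ∈ A.1 := by
  simp [star]

theorem card_edge (n r : ℕ) : Fintype.card (Edge n r) = n.choose r := by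
  simp

theorem card_supersets (Y : Finset (Fin n)) (hY : Y.card ≤ r) :
    (Finset.univ.filter (fun A : Edge n r => Y ⊆ A.1)).card
      = (n - Y.card).choose (r - Y.card) := by
  classical
  have h := Finset.card_powersetCard (r - Y.card) Yᶜ
  rw [Finset.card_compl, Fintype.card_fin] at h
  rw [← h]
  refine Finset.card_bij (fun A _ => A.1 \ Y) ?_ ?_ ?_
  · intro A hA
    simp only [Finset.mem_filter, Finset.mem_univ, true_and] at hA
    rw [Finset.mem_powersetCard]
    refine ⟨fun v hv => by simp_all, ?_⟩
    rw [Finset.card_sdiff_of_subset hA, A.2]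
  · intro A hA B hB hAB
    simp only [Finset.mem_filter, Finset.mem_univ, true_and] at hA hB
    apply Subtype.ext
    rw [← Finset.sdiff_union_of_subset hA, ← Finset.sdiff_union_of_subset hB, hAB]
  · intro B hB
    rw [Finset.mem_powersetCard] at hB
    have hd : Disjoint B Y := by
      rw [Finset.disjoint_left]
      intro v hv hv'
      have := hB.1 hv
      simp_all
    refine ⟨⟨B ∪ Y, ?_⟩, ?_, ?_⟩
    · rw [Finset.card_union_of_disjoint hd, hB.2]; omega
    · simp
    · simp [Finset.union_sdiff_right, hd]

theorem card_star (hr : 1 ≤ r) (x : Fin n) :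
    (star r x).card = (n - 1).choose (r - 1) := by
  have := card_supersets (r := r) {x} (by simpa using hr)
  simpa [star] using this

theorem card_star_inter (hr : 2 ≤ r) {x y : Fin n} (hxy : x ≠ y) :
    (star r x ∩ star r y).card = (n - 2).choose (r - 2) := by
  have := card_supersets (r := r) {x, y} (by rw [Finset.card_pair hxy]; exact hr)
  rw [Finset.card_pair hxy] at this
  rw [← this, star, star, ← Finset.filter_and]
  congr 1
  ext A
  simp [Finset.insert_subset_iff]

theorem choose_mul_eq (hr : 1 ≤ r) (hn : 1 ≤ n) :
    n.choose r * r = n * (n - 1).choose (r - 1) := by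
  obtain ⟨r, rfl⟩ := Nat.exists_eq_add_of_le' hr
  obtain ⟨n, rfl⟩ := Nat.exists_eq_add_of_le' hn
  simpa using (Nat.add_one_mul_choose_eq n r).symm

/-- The set of the `r`-subsets of `[n]` which meet `B`. -/
def meeting (r : ℕ) (B : Finset (Fin n)) : RGraph n r :=
  Finset.univ.filter (fun A => ¬ Disjoint A.1 B)

@[simp] theorem mem_meeting {B : Finset (Fin n)} {A : Edge n r} :
    A ∈ meeting r B ↔ ¬ Disjoint A.1 B := by simp [meeting]

theorem meeting_eq_biUnion (B : Finset (Fin n)) : meeting r B = B.biUnion (star r) := by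
  ext A
  simp [Finset.not_disjoint_iff, and_comm]

theorem card_meeting_le (hr : 1 ≤ r) (B : Finset (Fin n)) :
    (meeting r B).card ≤ B.card * (n - 1).choose (r - 1) := by
  rw [meeting_eq_biUnion]
  exact Finset.card_biUnion_le_card_mul _ _ _ fun x _ => (card_star hr x).le

theorem card_star_inter_meeting_le (hr : 2 ≤ r) {v : Fin n} {B : Finset (Fin n)} (hv : v ∉ B) :
    (star r v ∩ meeting r B).card ≤ B.card * (n - 2).choose (r - 2) := by
  rw [meeting_eq_biUnion, Finset.inter_biUnion]
  refine Finset.card_biUnion_le_card_mul _ _ _ fun x hx => (card_star_inter hr ?_).le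
  rintro rfl
  exact hv hx

/-- Lists `[e_k, …, e_0]` of edges in which `e_0` contains `x` and consecutive edges meet. -/
def chains (r : ℕ) (x : Fin n) : ℕ → Finset (List (Edge n r))
  | 0 => (star r x).image fun e => [e]
  | k + 1 => (chains r x k).biUnion fun l =>
      (meeting r (l.head?.elim ∅ fun e => e.1)).image fun e => e :: l

theorem singleton_mem_chains {x : Fin n} {e : Edge n r} (h : x ∈ e.1) : [e] ∈ chains r x 0 := by
  simp [chains, h]

theorem cons_mem_chains {x : Fin n} {k : ℕ} {e f : Edge n r} {l : List (Edge n r)}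
    (hl : f :: l ∈ chains r x k) (h : ¬ Disjoint e.1 f.1) : e :: f :: l ∈ chains r x (k + 1) := by
  simp only [chains, Finset.mem_biUnion, Finset.mem_image]
  exact ⟨f :: l, hl, e, by simpa using h, rfl⟩

theorem length_of_mem_chains {x : Fin n} {k : ℕ} {l : List (Edge n r)}
    (hl : l ∈ chains r x k) : l.length = k + 1 := by
  induction k generalizing l with
  | zero =>
    simp only [chains, Finset.mem_image] at hl
    obtain ⟨e, _, rfl⟩ := hl
    rfl
  | succ k ih =>
    simp only [chains, Finset.mem_biUnion, Finset.mem_image] at hl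
    obtain ⟨l', hl', e, _, rfl⟩ := hl
    simp [ih hl']

theorem card_chains_le (hr : 1 ≤ r) (x : Fin n) (k : ℕ) :
    (chains r x k).card ≤ (r * (n - 1).choose (r - 1)) ^ (k + 1) := by
  induction k with
  | zero =>
    refine Finset.card_image_le.trans ?_
    rw [card_star hr]
    simpa using Nat.le_mul_of_pos_left _ hr
  | succ k ih =>
    rw [pow_succ]
    refine (Finset.card_biUnion_le_card_mul _ _ _ fun l _ => ?_).trans
      (Nat.mul_le_mul_right (r * (n - 1).choose (r - 1)) ih)
    refine Finset.card_image_le.trans ((card_meeting_le hr _).trans (Nat.mul_le_mul_right _ ?_))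
    rcases l with _ | ⟨e, l⟩
    · simp
    · simp [e.2]

end Counting

section Degrees

variable {n r : ℕ}

@[simp] theorem mem_graphAt {a : EdgeOrdering n r} {t : ℕ} {e : Edge n r} :
    e ∈ graphAt a t ↔ (a.symm e : ℕ) < t := by simp [graphAt]

theorem degree_graphAt (a : EdgeOrdering n r) (t : ℕ) (x : Fin n) :
    degree (graphAt a t) x = ((star r x).filter (fun e => (a.symm e : ℕ) < t)).card := by
  rw [degree, graphAt, star, Finset.filter_filter, Finset.filter_filter]
  simp only [and_comm]

instance : Nonempty (EdgeOrdering n r) :=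
  ⟨(Fintype.equivFinOfCardEq (card_edge n r)).symm⟩

/-- All vertices of `X` have low degree at time `M₀`, and all edges of `F` come before `M₁`. -/
theorem unifProb_low_degree_le (M₀ M₁ s k : ℕ) (X : Finset (Fin n)) (F : RGraph n r)
    (hM : ((X.biUnion (star r)) \ F).card + M₀ ≤ n.choose r)
    (hk : ((X.biUnion (star r)) \ F).card + F.card ≤ k) (hkN : k < n.choose r)
    {ρ : ℝ} (hρ : 0 < ρ) (hρ1 : ρ ≤ 1) :
    unifProb Finset.univ (fun a : EdgeOrdering n r =>
        (∀ x ∈ X, degree (graphAt a M₀) x ≤ s) ∧ ∀ e ∈ F, (a.symm e : ℕ) < M₁)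
      ≤ (ρ ^ (X.card * s))⁻¹ * ((M₁ : ℝ) / (n.choose r - k)) ^ F.card *
        (1 - (M₀ : ℝ) / n.choose r + ρ * (M₀ / (n.choose r - k)))
          ^ ((X.biUnion (star r)) \ F).card := by
  refine le_trans (unifProb_mono _ fun a _ ha => ⟨?_, ha.2⟩)
    (unifProb_few_and_before_le (N := n.choose r) M₀ M₁ (X.card * s) k
      ((X.biUnion (star r)) \ F) F Finset.sdiff_disjoint hM hk hkN hρ hρ1)
  calc _ ≤ ((X.biUnion (star r)).filter (fun e => (a.symm e : ℕ) < M₀)).card := by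
        gcongr
        exact Finset.sdiff_subset
    _ ≤ X.card * s := by
        rw [Finset.filter_biUnion]
        refine Finset.card_biUnion_le_card_mul _ _ _ fun x hx => ?_
        rw [← degree_graphAt]
        exact ha.1 x hx

theorem unifProb_isolated_eq (M : ℕ) (Z : RGraph n r) (hZ : Z.card + M ≤ n.choose r) :
    unifProb Finset.univ (fun a : EdgeOrdering n r => ∀ e ∈ Z, e ∉ graphAt a M)
      = ∏ i ∈ Finset.range Z.card, (((n.choose r : ℝ) - M - i) / (n.choose r - i)) := by
  rw [← unifProb_avoid_eq (N := n.choose r) M Z hZ]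
  simp

end Degrees

/-! ### Vertices of low degree and their first edges -/

section Structure

variable {n r : ℕ}

/-- The set of the vertices whose degree in `H_M` is less than `d`. -/
def lowSet (a : EdgeOrdering n r) (M d : ℕ) : Finset (Fin n) :=
  Finset.univ.filter (fun x => degree (graphAt a M) x < d)

/-- `e` is the first edge, in the ordering `a`, which contains `x`. -/
def IsFirstEdge (a : EdgeOrdering n r) (x : Fin n) (e : Edge n r) : Prop :=
  x ∈ e.1 ∧ ∀ f : Edge n r, x ∈ f.1 → a.symm e ≤ a.symm f

open Classical in
/-- The set of the first edges of the vertices of low degree. -/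
noncomputable def firstEdges (a : EdgeOrdering n r) (M d : ℕ) : RGraph n r :=
  Finset.univ.filter (fun e => ∃ x ∈ lowSet a M d, IsFirstEdge a x e)

/-- The set of the vertices covered by the first edges of the vertices of low degree. -/
noncomputable def absorbed (a : EdgeOrdering n r) (M d : ℕ) : Finset (Fin n) :=
  (firstEdges a M d).biUnion (fun e => e.1)

theorem mem_lowSet {a : EdgeOrdering n r} {M d : ℕ} {x : Fin n} :
    x ∈ lowSet a M d ↔ degree (graphAt a M) x < d := by simp [lowSet]

theorem mem_firstEdges {a : EdgeOrdering n r} {M d : ℕ} {e : Edge n r} :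
    e ∈ firstEdges a M d ↔ ∃ x ∈ lowSet a M d, IsFirstEdge a x e := by simp [firstEdges]

theorem mem_absorbed {a : EdgeOrdering n r} {M d : ℕ} {v : Fin n} :
    v ∈ absorbed a M d ↔ ∃ e ∈ firstEdges a M d, v ∈ e.1 := by simp [absorbed]

theorem IsFirstEdge.unique {a : EdgeOrdering n r} {x : Fin n} {e f : Edge n r}
    (he : IsFirstEdge a x e) (hf : IsFirstEdge a x f) : e = f :=
  a.symm.injective (le_antisymm (he.2 f hf.1) (hf.2 e he.1))

theorem star_nonempty (hr : 1 ≤ r) (hrn : r ≤ n) (x : Fin n) : (star r x).Nonempty := by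
  rw [← Finset.card_pos, card_star hr]
  exact Nat.choose_pos (by omega)

theorem exists_isFirstEdge (hr : 1 ≤ r) (hrn : r ≤ n) (a : EdgeOrdering n r) (x : Fin n) :
    ∃ e, IsFirstEdge a x e := by
  obtain ⟨e, he, h⟩ := Finset.exists_min_image (star r x) a.symm (star_nonempty hr hrn x)
  exact ⟨e, by simpa using he, fun f hf => h f (by simpa using hf)⟩

theorem lowSet_subset_absorbed (hr : 1 ≤ r) (hrn : r ≤ n) (a : EdgeOrdering n r) (M d : ℕ) :
    lowSet a M d ⊆ absorbed a M d := by
  intro x hx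
  obtain ⟨e, he⟩ := exists_isFirstEdge hr hrn a x
  exact mem_absorbed.2 ⟨e, mem_firstEdges.2 ⟨x, hx, he⟩, he.1⟩

theorem hittingTime_spec (hr : 1 ≤ r) (hrn : r ≤ n) (a : EdgeOrdering n r) (v : Fin n) :
    ∃ A ∈ graphAt a (hittingTime a), v ∈ A.1 := by
  have : hittingTime a ∈ {t : ℕ | ∀ v : Fin n, ∃ A ∈ graphAt a t, v ∈ A.1} := by
    refine Nat.sInf_mem ⟨n.choose r, fun v => ?_⟩
    obtain ⟨e, he⟩ := star_nonempty hr hrn v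
    exact ⟨e, by simp, by simpa using he⟩
  exact this v

theorem IsFirstEdge.mem_graphAt {a : EdgeOrdering n r} {x : Fin n} {e : Edge n r} {t : ℕ}
    (he : IsFirstEdge a x e) (h : ∃ A ∈ graphAt a t, x ∈ A.1) : e ∈ graphAt a t := by
  obtain ⟨A, hA, hx⟩ := h
  rw [Shamir.mem_graphAt] at hA ⊢
  exact lt_of_le_of_lt (he.2 A hx) hA

theorem card_graphAt (a : EdgeOrdering n r) {t : ℕ} (ht : t ≤ n.choose r) :
    (graphAt a t).card = t := by
  have h : graphAt a t
      = (Finset.univ.filter (fun i : Fin (n.choose r) => (i : ℕ) < t)).map a.toEmbedding := by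
    ext e
    simp
  rw [h, Finset.card_map, Fin.card_filter_val_lt, min_eq_right ht]

/-- The local structure around the vertices of low degree which holds with high probability:
there are at most `w` such vertices, their first edges are pairwise disjoint, no edge of `H_M`
meets two of those first edges, and a vertex which is not absorbed is in at most one edge of `H_M`
that meets the absorbed set. -/
structure IsSparse (a : EdgeOrdering n r) (M d w : ℕ) : Prop where
  card_le : (lowSet a M d).card ≤ w
  disjoint : ∀ e ∈ firstEdges a M d, ∀ f ∈ firstEdges a M d, e ≠ f → Disjoint e.1 f.1
  not_bridge : ∀ g ∈ graphAt a M, ∀ e ∈ firstEdges a M d, ∀ f ∈ firstEdges a M d, e ≠ f →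
    ¬ Disjoint g.1 e.1 → Disjoint g.1 f.1
  unique : ∀ v ∉ absorbed a M d, ∀ e ∈ graphAt a M, ∀ f ∈ graphAt a M, v ∈ e.1 → v ∈ f.1 →
    e ∈ meeting r (absorbed a M d) → f ∈ meeting r (absorbed a M d) → e = f

variable {a : EdgeOrdering n r} {M d w : ℕ}

theorem card_firstEdges_le (a : EdgeOrdering n r) (M d : ℕ) :
    (firstEdges a M d).card ≤ (lowSet a M d).card := by
  classical
  have h : firstEdges a M d
      = (lowSet a M d).biUnion fun x => Finset.univ.filter (IsFirstEdge a x) := by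
    ext e
    simp [mem_firstEdges]
  rw [h, ← mul_one (lowSet a M d).card]
  refine Finset.card_biUnion_le_card_mul _ _ _ fun x _ => Finset.card_le_one.2 ?_
  intro e he f hf
  exact (Finset.mem_filter.1 he).2.unique (Finset.mem_filter.1 hf).2

theorem IsSparse.card_absorbed (h : IsSparse a M d w) :
    (absorbed a M d).card = (firstEdges a M d).card * r := by
  rw [absorbed, Finset.card_biUnion h.disjoint]
  simp [Finset.sum_congr rfl fun (e : Edge n r) _ => e.2]

theorem IsSparse.card_meeting_le (hr : 1 ≤ r) (h : IsSparse a M d w) :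
    (graphAt a M ∩ meeting r (absorbed a M d)).card ≤ 2 * n := by
  classical
  set U := absorbed a M d
  set H := graphAt a M ∩ meeting r U
  rw [← Finset.card_filter_add_card_filter_not (fun e : Edge n r => e.1 ⊆ U), two_mul]
  refine add_le_add ?_ ?_
  · have h1 : H.filter (fun e => e.1 ⊆ U) ⊆ firstEdges a M d := by
      intro e he
      simp only [H, Finset.mem_filter, Finset.mem_inter, mem_meeting, Finset.not_disjoint_iff] at he
      obtain ⟨⟨heM, u, hue, huU⟩, heU⟩ := he
      obtain ⟨f, hf, huf⟩ := mem_absorbed.1 huU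
      have hsub : e.1 ⊆ f.1 := by
        intro v hv
        obtain ⟨g, hg, hvg⟩ := mem_absorbed.1 (heU hv)
        by_cases hfg : f = g
        · exact hfg ▸ hvg
        · have := h.not_bridge e heM f hf g hg hfg (Finset.not_disjoint_iff.2 ⟨u, hue, huf⟩)
          exact absurd hvg (Finset.disjoint_left.1 this hv)
      have : e = f := Subtype.ext (Finset.eq_of_subset_of_card_le hsub (by rw [e.2, f.2]))
      exact this ▸ hf
    refine (Finset.card_le_card h1).trans ((card_firstEdges_le a M d).trans ?_)
    exact (Finset.card_le_univ _).trans (by simp)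
  · have h1 : ∀ e ∈ H.filter (fun e => ¬ e.1 ⊆ U), ∃ v, v ∈ e.1 ∧ v ∉ U :=
      fun e he => Finset.not_subset.1 (Finset.mem_filter.1 he).2
    by_cases hn : n = 0
    · have : IsEmpty (Edge n r) := by
        subst hn
        refine ⟨fun e => ?_⟩
        have := e.2
        rw [Finset.eq_empty_of_isEmpty e.1] at this
        simp at this; omega
      simp [Finset.eq_empty_of_isEmpty]
    · have : Nonempty (Fin n) := ⟨⟨0, by omega⟩⟩
      choose! φ hφ hφ' using h1
      calc _ ≤ (Finset.univ : Finset (Fin n)).card := by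
            refine Finset.card_le_card_of_injOn φ (fun _ _ => Finset.mem_univ _) ?_
            intro e he f hf hef
            have he' := (Finset.mem_inter.1 (Finset.mem_filter.1 he).1)
            have hf' := (Finset.mem_inter.1 (Finset.mem_filter.1 hf).1)
            exact h.unique (φ e) (hφ' e he) e he'.1 f hf'.1 (hφ e he) (hef ▸ hφ f hf) he'.2 hf'.2
        _ = n := by simp

end Structure

section Restriction

variable {n n' r : ℕ}

/-- The map on `r`-sets induced by an injection of vertex sets. -/
def edgeMap (r : ℕ) (j : Fin n' ↪ Fin n) : Edge n' r ↪ Edge n r where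
  toFun A := ⟨A.1.map j, by rw [Finset.card_map, A.2]⟩
  inj' A B h := Subtype.ext (Finset.map_injective j (Subtype.ext_iff.1 h))

/-- The subgraph of `H_M` induced on the range of `j`, as a graph on `[n']`. -/
def inducedAt (j : Fin n' ↪ Fin n) (a : EdgeOrdering n r) (M : ℕ) : RGraph n' r :=
  Finset.univ.filter (fun A => (a.symm (edgeMap r j A) : ℕ) < M)

@[simp] theorem mem_inducedAt {j : Fin n' ↪ Fin n} {a : EdgeOrdering n r} {M : ℕ}
    {A : Edge n' r} : A ∈ inducedAt j a M ↔ (a.symm (edgeMap r j A) : ℕ) < M := by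
  simp [inducedAt]

@[simp] theorem coe_edgeMap (j : Fin n' ↪ Fin n) (A : Edge n' r) :
    (edgeMap r j A).1 = A.1.map j := rfl

variable {U : Finset (Fin n)} {j : Fin n' ↪ Fin n}

theorem edgeMap_notMem_meeting (hj : Set.range j = (U : Set (Fin n))ᶜ) (A : Edge n' r) :
    edgeMap r j A ∉ meeting r U := by
  rw [mem_meeting, not_not, Finset.disjoint_left]
  intro v hv hvU
  obtain ⟨u, _, rfl⟩ := Finset.mem_map.1 hv
  have : j u ∈ (U : Set (Fin n))ᶜ := hj ▸ Set.mem_range_self u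
  exact this (by simpa using hvU)

theorem exists_edgeMap_eq (hj : Set.range j = (U : Set (Fin n))ᶜ) {e : Edge n r}
    (he : e ∉ meeting r U) : ∃ A, edgeMap r j A = e := by
  rw [mem_meeting, not_not, Finset.disjoint_left] at he
  have h : ∀ v ∈ e.1, v ∈ Set.range j := by
    intro v hv
    rw [hj]
    simpa using he hv
  obtain ⟨B, hB⟩ : ∃ B : Finset (Fin n'), B.map j = e.1 := by
    refine ⟨e.1.preimage j j.injective.injOn, ?_⟩
    ext v
    simp only [Finset.mem_map, Finset.mem_preimage]
    constructor
    · rintro ⟨u, hu, rfl⟩; exact hu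
    · intro hv
      obtain ⟨u, rfl⟩ := h v hv
      exact ⟨u, hv, rfl⟩
  refine ⟨⟨B, ?_⟩, Subtype.ext hB⟩
  rw [← Finset.card_map j, hB, e.2]

theorem graphAt_sdiff_meeting (hj : Set.range j = (U : Set (Fin n))ᶜ) (a : EdgeOrdering n r)
    (M : ℕ) : graphAt a M \ meeting r U = (inducedAt j a M).map (edgeMap r j) := by
  ext e
  simp only [Finset.mem_sdiff, mem_graphAt, Finset.mem_map, mem_inducedAt]
  constructor
  · rintro ⟨h1, h2⟩
    obtain ⟨A, rfl⟩ := exists_edgeMap_eq hj h2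
    exact ⟨A, h1, rfl⟩
  · rintro ⟨A, h, rfl⟩
    exact ⟨h, edgeMap_notMem_meeting hj A⟩

theorem card_inducedAt (hj : Set.range j = (U : Set (Fin n))ᶜ) (a : EdgeOrdering n r) (M : ℕ) :
    (inducedAt j a M).card + (graphAt a M ∩ meeting r U).card = (graphAt a M).card := by
  rw [← Finset.card_map (edgeMap r j), ← graphAt_sdiff_meeting hj,
    Finset.card_sdiff_add_card_inter]

theorem degree_eq_add (hj : Set.range j = (U : Set (Fin n))ᶜ) (a : EdgeOrdering n r) (M : ℕ)
    (v : Fin n') :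
    degree (graphAt a M) (j v) = degree (inducedAt j a M) v
      + ((graphAt a M ∩ meeting r U).filter (fun e => j v ∈ e.1)).card := by
  have h : degree (inducedAt j a M) v
      = ((graphAt a M \ meeting r U).filter (fun e => j v ∈ e.1)).card := by
    rw [graphAt_sdiff_meeting hj, Finset.filter_map, Finset.card_map, degree]
    congr 1
    ext A
    simp
  rw [h, degree, ← Finset.card_union_of_disjoint, ← Finset.filter_union,
    Finset.sdiff_union_inter]
  exact Finset.disjoint_filter_filter (Finset.disjoint_sdiff_inter _ _)

theorem graphAt_inter_congr {a b : EdgeOrdering n r} {E : RGraph n r}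
    (h : ∀ e ∈ E, b.symm e = a.symm e) (M : ℕ) : graphAt b M ∩ E = graphAt a M ∩ E := by
  ext e
  simp only [Finset.mem_inter, mem_graphAt, and_congr_left_iff]
  intro he
  rw [h e he]

/-- Permuting the edges outside `U` shows that, once the positions of all edges meeting `U` are
fixed, the induced graph outside `U` takes each value of the right size equally often. -/
theorem card_agree_inducedAt_le (hj : Set.range j = (U : Set (Fin n))ᶜ) (a₀ : EdgeOrdering n r)
    (M : ℕ) {S S' : RGraph n' r} (hS : S.card = S'.card)
    [DecidablePred fun a : EdgeOrdering n r => ∀ e ∈ meeting r U, a.symm e = a₀.symm e] :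
    (Finset.univ.filter (fun a : EdgeOrdering n r =>
        (∀ e ∈ meeting r U, a.symm e = a₀.symm e) ∧ inducedAt j a M = S)).card
      ≤ (Finset.univ.filter (fun a : EdgeOrdering n r =>
        (∀ e ∈ meeting r U, a.symm e = a₀.symm e) ∧ inducedAt j a M = S')).card := by
  classical
  let σ : Equiv.Perm (Edge n' r) := (Finset.equivOfCardEq hS).extendSubtype
  have hσ : ∀ A, σ A ∈ S' ↔ A ∈ S := by
    intro A
    constructor
    · intro h
      by_contra hA
      exact (Finset.equivOfCardEq hS).extendSubtype_not_mem A hA h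
    · exact (Finset.equivOfCardEq hS).extendSubtype_mem A
  let τ : Equiv.Perm (Edge n r) := σ.viaEmbedding (edgeMap r j)
  have hτ : ∀ A, τ (edgeMap r j A) = edgeMap r j (σ A) := σ.viaEmbedding_apply _
  have hτ' : ∀ e ∈ meeting r U, τ e = e := by
    intro e he
    refine σ.viaEmbedding_apply_of_notMem _ e ?_
    rintro ⟨A, rfl⟩
    exact edgeMap_notMem_meeting hj A he
  refine Finset.card_le_card_of_injOn (fun a => a.trans τ) ?_ ?_
  · intro a ha
    simp only [Finset.coe_filter, Finset.mem_univ, true_and, Set.mem_ofPred_eq] at ha ⊢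
    obtain ⟨h1, rfl⟩ := ha
    refine ⟨fun e he => ?_, ?_⟩
    · rw [Equiv.symm_trans_apply, (Equiv.symm_apply_eq τ).2 (hτ' e he).symm, h1 e he]
    · ext B
      obtain ⟨A, rfl⟩ := σ.surjective B
      rw [hσ, mem_inducedAt, mem_inducedAt, Equiv.symm_trans_apply, ← hτ, Equiv.symm_apply_apply]
  · intro a _ b _ h
    exact Equiv.ext fun i => τ.injective (Equiv.congr_fun h i)

end Restriction

/-! ### Conditioning on the edges that meet the absorbed set -/

section Fibers

variable {n n' r : ℕ} {M d w : ℕ}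

theorem lowSet_eq_of_agree (hr : 1 ≤ r) (hrn : r ≤ n) {a₀ a : EdgeOrdering n r}
    (h : ∀ e ∈ meeting r (absorbed a₀ M d), a.symm e = a₀.symm e)
    (hd : ∀ v ∉ absorbed a₀ M d, d ≤ degree (graphAt a M) v) :
    lowSet a M d = lowSet a₀ M d := by
  ext v
  rw [mem_lowSet, mem_lowSet]
  by_cases hv : v ∈ absorbed a₀ M d
  · rw [degree_graphAt, degree_graphAt]
    have : ∀ e ∈ star r v, a.symm e = a₀.symm e := fun e he =>
      h e (mem_meeting.2 (Finset.not_disjoint_iff.2 ⟨v, mem_star.1 he, hv⟩))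
    rw [Finset.filter_congr fun e he => by rw [this e he]]
  · have h1 : ¬ degree (graphAt a₀ M) v < d := fun hlt =>
      hv (lowSet_subset_absorbed hr hrn a₀ M d (mem_lowSet.2 hlt))
    exact iff_of_false (not_lt.2 (hd v hv)) h1

theorem absorbed_eq_of_agree (hr : 1 ≤ r) (hrn : r ≤ n) {a₀ a : EdgeOrdering n r}
    (h : ∀ e ∈ meeting r (absorbed a₀ M d), a.symm e = a₀.symm e)
    (hd : ∀ v ∉ absorbed a₀ M d, d ≤ degree (graphAt a M) v) :
    absorbed a M d = absorbed a₀ M d := by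
  have hW := lowSet_eq_of_agree hr hrn h hd
  have hF : firstEdges a M d = firstEdges a₀ M d := by
    ext e
    rw [mem_firstEdges, mem_firstEdges, hW]
    refine exists_congr fun x => and_congr_right fun hx => and_congr_right fun hxe => ?_
    have hxU := lowSet_subset_absorbed hr hrn a₀ M d hx
    have h' : ∀ f : Edge n r, x ∈ f.1 → a.symm f = a₀.symm f := fun f hf =>
      h f (mem_meeting.2 (Finset.not_disjoint_iff.2 ⟨x, hf, hxU⟩))
    refine forall_congr' fun f => imp_congr_right fun hf => ?_
    rw [h' e hxe, h' f hf]
  rw [absorbed, absorbed, hF]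

/-- The orderings with the same absorbed set as `a₀` and the same positions of the edges meeting
it are given by lower bounds for the degrees in the induced graph. -/
theorem absorbed_eq_and_agree_iff (hr : 1 ≤ r) (hrn : r ≤ n) {a₀ a : EdgeOrdering n r}
    {j : Fin n' ↪ Fin n} (hj : Set.range j = (absorbed a₀ M d : Set (Fin n))ᶜ) :
    (absorbed a M d = absorbed a₀ M d ∧
        ∀ e ∈ meeting r (absorbed a₀ M d), a.symm e = a₀.symm e) ↔
      (∀ e ∈ meeting r (absorbed a₀ M d), a.symm e = a₀.symm e) ∧
        ∀ v, d - ((graphAt a₀ M ∩ meeting r (absorbed a₀ M d)).filter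
          (fun e => j v ∈ e.1)).card ≤ degree (inducedAt j a M) v := by
  rw [and_comm, and_congr_right_iff]
  intro h
  have hdeg : (∀ v, d - ((graphAt a₀ M ∩ meeting r (absorbed a₀ M d)).filter
          (fun e => j v ∈ e.1)).card ≤ degree (inducedAt j a M) v) ↔
      ∀ v ∉ absorbed a₀ M d, d ≤ degree (graphAt a M) v := by
    have h1 : ∀ v, d - ((graphAt a₀ M ∩ meeting r (absorbed a₀ M d)).filter
          (fun e => j v ∈ e.1)).card ≤ degree (inducedAt j a M) v ↔
        d ≤ degree (graphAt a M) (j v) := by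
      intro v
      rw [degree_eq_add hj, graphAt_inter_congr h, tsub_le_iff_right]
    simp only [h1]
    constructor
    · intro h2 v hv
      obtain ⟨u, rfl⟩ : v ∈ Set.range j := by rw [hj]; simpa using hv
      exact h2 u
    · intro h2 v
      refine h2 _ fun hv => ?_
      have : j v ∈ (absorbed a₀ M d : Set (Fin n))ᶜ := hj ▸ Set.mem_range_self v
      exact this hv
  rw [hdeg]
  refine ⟨fun hU v hv => ?_, absorbed_eq_of_agree hr hrn h⟩
  rw [← hU] at hv
  by_contra hlt
  exact hv (lowSet_subset_absorbed hr hrn a M d (mem_lowSet.2 (not_le.1 hlt)))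

/-- Adding the first edges of the vertices of low degree turns a perfect matching of the graph
induced outside the absorbed set into one of `H_T`. -/
theorem numPM_inducedAt_le (hr : 1 ≤ r) (hrn : r ≤ n) {a : EdgeOrdering n r}
    (h : IsSparse a M d w) (hT : M ≤ hittingTime a) {j : Fin n' ↪ Fin n}
    (hj : Set.range j = (absorbed a M d : Set (Fin n))ᶜ) (hn' : n' + (absorbed a M d).card = n) :
    numPM (inducedAt j a M) ≤ numPM (graphAt a (hittingTime a)) := by
  classical
  have hdisj : ∀ m : RGraph n' r, ∀ A ∈ m.map (edgeMap r j), ∀ f ∈ firstEdges a M d,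
      Disjoint A.1 f.1 := by
    intro m A hA f hf
    obtain ⟨B, _, rfl⟩ := Finset.mem_map.1 hA
    have := edgeMap_notMem_meeting hj B
    rw [mem_meeting, not_not] at this
    exact Finset.disjoint_of_subset_right (fun v hv => mem_absorbed.2 ⟨f, hf, hv⟩) this
  have hdisj' : ∀ m : RGraph n' r, Disjoint (m.map (edgeMap r j)) (firstEdges a M d) := by
    intro m
    rw [Finset.disjoint_left]
    intro A hA hf
    have := hdisj m A hA A hf
    rw [disjoint_self, Finset.bot_eq_empty, ← Finset.card_eq_zero, A.2] at this
    omega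
  unfold numPM
  refine Finset.card_le_card_of_injOn (fun m => m.map (edgeMap r j) ∪ firstEdges a M d) ?_ ?_
  · intro m hm
    simp only [Finset.coe_filter, Finset.mem_univ, true_and, Set.mem_ofPred_eq] at hm ⊢
    obtain ⟨hmH, hmd, hmc⟩ := hm
    refine ⟨?_, ?_, ?_⟩
    · refine Finset.union_subset ?_ ?_
      · intro A hA
        obtain ⟨B, hB, rfl⟩ := Finset.mem_map.1 hA
        exact mem_graphAt.2 (lt_of_lt_of_le (mem_inducedAt.1 (hmH hB)) hT)
      · intro e he
        obtain ⟨x, _, hx⟩ := mem_firstEdges.1 he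
        exact hx.mem_graphAt (hittingTime_spec hr hrn a x)
    · intro A hA B hB hAB
      rcases Finset.mem_union.1 hA with hA | hA <;> rcases Finset.mem_union.1 hB with hB | hB
      · obtain ⟨A, hA', rfl⟩ := Finset.mem_map.1 hA
        obtain ⟨B, hB', rfl⟩ := Finset.mem_map.1 hB
        rw [coe_edgeMap, coe_edgeMap, Finset.disjoint_map]
        exact hmd A hA' B hB' fun h => hAB (h ▸ rfl)
      · exact hdisj m A hA B hB
      · exact (hdisj m B hB A hA).symm
      · exact h.disjoint A hA B hB hAB
    · rw [Finset.card_union_of_disjoint (hdisj' m), Finset.card_map, add_mul, hmc,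
        ← h.card_absorbed, hn']
  · intro m _ m' _ hmm
    have h1 : ∀ m : RGraph n' r, (m.map (edgeMap r j) ∪ firstEdges a M d) \ firstEdges a M d
        = m.map (edgeMap r j) := by
      intro m
      rw [Finset.union_sdiff_right, (hdisj' m).sdiff_eq_left]
    apply Finset.map_injective (edgeMap r j)
    rw [← h1 m, ← h1 m']
    exact congrArg (· \ firstEdges a M d) hmm

open Classical in
/-- Once the positions of all edges meeting `U` are fixed, the induced graph outside `U` is
uniformly random among the graphs with the right number of edges. -/
theorem exists_card_agree_eq {U : Finset (Fin n)} {j : Fin n' ↪ Fin n}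
    (hj : Set.range j = (U : Set (Fin n))ᶜ) (hM : M ≤ n.choose r) (a₀ : EdgeOrdering n r) :
    ∃ c : ℕ, ∀ P : RGraph n' r → Prop,
      (Finset.univ.filter (fun a : EdgeOrdering n r =>
        (∀ e ∈ meeting r U, a.symm e = a₀.symm e) ∧ P (inducedAt j a M))).card
      = c * ((graphsWithEdges n' r (inducedAt j a₀ M).card).filter P).card := by
  set M' := (inducedAt j a₀ M).card
  refine ⟨(Finset.univ.filter (fun a : EdgeOrdering n r =>
        (∀ e ∈ meeting r U, a.symm e = a₀.symm e) ∧
          inducedAt j a M = inducedAt j a₀ M)).card, fun P => ?_⟩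
  rw [mul_comm]
  have hmaps : ∀ a ∈ Finset.univ.filter (fun a : EdgeOrdering n r =>
        (∀ e ∈ meeting r U, a.symm e = a₀.symm e) ∧ P (inducedAt j a M)),
      inducedAt j a M ∈ (graphsWithEdges n' r M').filter P := by
    intro a ha
    obtain ⟨h1, h2⟩ := (Finset.mem_filter.1 ha).2
    refine Finset.mem_filter.2 ⟨?_, h2⟩
    rw [graphsWithEdges, Finset.mem_powersetCard]
    refine ⟨Finset.subset_univ _, ?_⟩
    have h3 := card_inducedAt hj a M
    have h4 := card_inducedAt hj a₀ M
    rw [card_graphAt _ hM] at h3 h4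
    rw [graphAt_inter_congr h1] at h3
    omega
  rw [Finset.card_eq_sum_card_fiberwise hmaps, Finset.sum_eq_card_nsmul, smul_eq_mul]
  intro S hS
  obtain ⟨hS, hP⟩ := Finset.mem_filter.1 hS
  have hS' : S.card = M' := (Finset.mem_powersetCard.1 hS).2
  rw [Finset.filter_filter]
  have h5 : (Finset.univ.filter (fun a : EdgeOrdering n r =>
        ((∀ e ∈ meeting r U, a.symm e = a₀.symm e) ∧ P (inducedAt j a M)) ∧
          inducedAt j a M = S)) = Finset.univ.filter (fun a : EdgeOrdering n r =>
        (∀ e ∈ meeting r U, a.symm e = a₀.symm e) ∧ inducedAt j a M = S) := by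
    refine Finset.filter_congr fun a _ => ?_
    constructor
    · rintro ⟨⟨h1, _⟩, h2⟩; exact ⟨h1, h2⟩
    · rintro ⟨h1, h2⟩; exact ⟨⟨h1, h2 ▸ hP⟩, h2⟩
  rw [h5]
  exact le_antisymm (card_agree_inducedAt_le hj a₀ M hS')
    (card_agree_inducedAt_le hj a₀ M hS'.symm)

theorem card_filter_and_le_of_unifCondProb_le {Ω : Type} {S : Finset Ω} {p q : Ω → Prop}
    [DecidablePred p] [DecidablePred q] {β : ℝ} (h : unifCondProb S p q ≤ β)
    (hq : (S.filter q).Nonempty) :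
    ((S.filter (fun ω => p ω ∧ q ω)).card : ℝ) ≤ β * (S.filter q).card := by
  have hy : (0 : ℝ) < (S.filter q).card := by exact_mod_cast hq.card_pos
  have hg : (0 : ℝ) < S.card := by
    exact_mod_cast hq.card_pos.trans_le (Finset.card_filter_le _ _)
  rwa [unifCondProb, unifProb_eq, unifProb_eq, div_div_div_cancel_right₀ hg.ne',
    div_le_iff₀ hy] at h

theorem cast_le_mul_of_proportional {b f c x y : ℕ} {β : ℝ} (h₁ : b ≤ c * x) (h₀ : f = c * y)
    (h : (x : ℝ) ≤ β * y) : (b : ℝ) ≤ β * f := by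
  calc (b : ℝ) ≤ c * x := by exact_mod_cast h₁
    _ ≤ c * (β * y) := by gcongr
    _ = β * f := by rw [h₀]; push_cast; ring

/-- If conditional counting holds, with failure probability `β`, for all the induced graphs that
can occur, then `H_T` has at most `B` perfect matchings with probability at most `β` as far as the
sparse orderings are concerned. -/
theorem unifProb_sparse_few_PM_le (hr : 1 ≤ r) (hrn : r ≤ n) (hM : M ≤ n.choose r) {β B : ℝ}
    (hβ : 0 ≤ β)
    (hcount : ∀ (n' M' : ℕ) (δ : Fin n' → ℕ), (∃ k ≤ w, n' + k * r = n) →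
      M' ≤ M → M ≤ M' + 2 * n → (∀ v, δ v ≤ d ∧ d ≤ δ v + 1) →
      unifCondProb (graphsWithEdges n' r M') (fun H => (numPM H : ℝ) ≤ B)
        (fun H => ∀ x, δ x ≤ degree H x) ≤ β) :
    unifProb Finset.univ (fun a : EdgeOrdering n r => IsSparse a M d w ∧ M ≤ hittingTime a ∧
      (numPM (graphAt a (hittingTime a)) : ℝ) ≤ B) ≤ β := by
  classical
  -- `κ a` records the absorbed set and the positions of the edges meeting it
  let κ : EdgeOrdering n r → Finset (Fin n) × (Edge n r → Option (Fin (n.choose r))) :=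
    fun a => (absorbed a M d,
      fun e => if e ∈ meeting r (absorbed a M d) then some (a.symm e) else none)
  let bad : EdgeOrdering n r → Prop := fun a => IsSparse a M d w ∧ M ≤ hittingTime a ∧
      (numPM (graphAt a (hittingTime a)) : ℝ) ≤ B
  have hκ : ∀ a a₀, κ a = κ a₀ ↔ (absorbed a M d = absorbed a₀ M d ∧
        ∀ e ∈ meeting r (absorbed a₀ M d), a.symm e = a₀.symm e) := by
    intro a a₀
    simp only [κ, Prod.mk.injEq]
    refine and_congr_right fun hU => ?_
    rw [funext_iff, hU]
    refine forall_congr' fun e => ?_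
    by_cases he : e ∈ meeting r (absorbed a₀ M d) <;> simp [he]
  have hfib : ∀ a₀, bad a₀ →
      ((Finset.univ.filter (fun a => κ a = κ a₀ ∧ bad a)).card : ℝ)
        ≤ β * (Finset.univ.filter (fun a => κ a = κ a₀)).card := by
    intro a₀ hbad
    have hsp := hbad.1
    set U := absorbed a₀ M d with hU
    have hcard : (Uᶜ).card = n - U.card := by rw [Finset.card_compl, Fintype.card_fin]
    have hUn : U.card ≤ n := (Finset.card_le_univ _).trans (by simp)
    set j : Fin (n - U.card) ↪ Fin n := (Uᶜ.orderEmbOfFin hcard).toEmbedding with hjdef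
    have hj : Set.range j = (U : Set (Fin n))ᶜ := by
      have := Finset.range_orderEmbOfFin Uᶜ hcard
      rw [Finset.coe_compl] at this
      exact this
    obtain ⟨c, hc₀⟩ := exists_card_agree_eq hj hM a₀
    have hc : ∀ (P : RGraph (n - U.card) r → Prop) [DecidablePred P],
        (Finset.univ.filter (fun a : EdgeOrdering n r =>
          (∀ e ∈ meeting r U, a.symm e = a₀.symm e) ∧ P (inducedAt j a M))).card
        = c * ((graphsWithEdges (n - U.card) r (inducedAt j a₀ M).card).filter P).card := by
      intro P _
      convert hc₀ P
    set M' := (inducedAt j a₀ M).card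
    set δ : Fin (n - U.card) → ℕ := fun v => d - ((graphAt a₀ M ∩ meeting r U).filter
          (fun e => j v ∈ e.1)).card
    have hfiber : Finset.univ.filter (fun a => κ a = κ a₀) = Finset.univ.filter
        (fun a : EdgeOrdering n r => (∀ e ∈ meeting r U, a.symm e = a₀.symm e) ∧
          ∀ v, δ v ≤ degree (inducedAt j a M) v) := by
      refine Finset.filter_congr fun a _ => ?_
      rw [hκ]
      exact absorbed_eq_and_agree_iff hr hrn hj
    have hbadfib : Finset.univ.filter (fun a => κ a = κ a₀ ∧ bad a) ⊆ Finset.univ.filter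
        (fun a : EdgeOrdering n r => (∀ e ∈ meeting r U, a.symm e = a₀.symm e) ∧
          ((numPM (inducedAt j a M) : ℝ) ≤ B ∧ ∀ v, δ v ≤ degree (inducedAt j a M) v)) := by
      intro a ha
      obtain ⟨hκa, hsa, hTa, hBa⟩ := (Finset.mem_filter.1 ha).2
      have h1 : a ∈ Finset.univ.filter (fun a => κ a = κ a₀) :=
        Finset.mem_filter.2 ⟨Finset.mem_univ _, hκa⟩
      rw [hfiber] at h1
      obtain ⟨h2, h3⟩ := (Finset.mem_filter.1 h1).2
      have hUa := ((hκ a a₀).1 hκa).1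
      refine Finset.mem_filter.2 ⟨Finset.mem_univ _, h2, le_trans ?_ hBa, h3⟩
      exact_mod_cast numPM_inducedAt_le hr hrn hsa hTa (by rw [hUa]; exact hj)
        (by rw [hUa, ← hU]; omega)
    have hcc := hcount (n - U.card) M' δ
      ⟨(firstEdges a₀ M d).card, (card_firstEdges_le a₀ M d).trans hsp.card_le, by
        rw [← hsp.card_absorbed, ← hU]; omega⟩ ?_ ?_ ?_
    · -- both cardinalities are `c` times those of the corresponding sets of graphs
      have h1 := Finset.card_le_card hbadfib
      rw [hc (fun H => (numPM H : ℝ) ≤ B ∧ ∀ v, δ v ≤ degree H v)] at h1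
      have h0 : (Finset.univ.filter (fun a => κ a = κ a₀)).card
          = c * ((graphsWithEdges (n - U.card) r M').filter
            (fun H => ∀ v, δ v ≤ degree H v)).card := by
        rw [hfiber]
        exact hc (fun H => ∀ v, δ v ≤ degree H v)
      have h2 : 0 < (Finset.univ.filter (fun a => κ a = κ a₀)).card :=
        Finset.card_pos.2 ⟨a₀, Finset.mem_filter.2 ⟨Finset.mem_univ _, rfl⟩⟩
      have h3 := card_filter_and_le_of_unifCondProb_le hcc
        (Finset.card_pos.1 (Nat.pos_of_mul_pos_left (h0 ▸ h2)))
      exact cast_le_mul_of_proportional h1 h0 h3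
    · have := card_inducedAt hj a₀ M
      rw [card_graphAt _ hM] at this
      omega
    · have := card_inducedAt hj a₀ M
      rw [card_graphAt _ hM] at this
      have h2 := hsp.card_meeting_le hr
      rw [← hU] at h2
      omega
    · intro v
      have hv : ((graphAt a₀ M ∩ meeting r U).filter (fun e => j v ∈ e.1)).card ≤ 1 := by
        refine Finset.card_le_one.2 fun e he f hf => ?_
        simp only [Finset.mem_filter, Finset.mem_inter] at he hf
        refine hsp.unique (j v) ?_ e he.1.1 f hf.1.1 he.2 hf.2 he.1.2 hf.1.2
        have : j v ∈ (U : Set (Fin n))ᶜ := hj ▸ Set.mem_range_self v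
        simpa using this
      simp only [δ]
      omega
  rw [unifProb_eq, div_le_iff₀ (by
    exact_mod_cast Finset.card_pos.2 (Finset.univ_nonempty (α := EdgeOrdering n r)))]
  rw [Finset.card_eq_sum_card_fiberwise (f := κ) (t := Finset.univ.image κ)
      (s := Finset.univ.filter _)
      (fun a _ => Finset.mem_coe.2 (Finset.mem_image_of_mem _ (Finset.mem_univ _))),
    Finset.card_eq_sum_card_fiberwise (f := κ) (t := Finset.univ.image κ)
      (s := Finset.univ)
      (fun a _ => Finset.mem_coe.2 (Finset.mem_image_of_mem _ (Finset.mem_univ _)))]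
  push_cast
  rw [Finset.mul_sum]
  refine Finset.sum_le_sum fun y _ => ?_
  by_cases hy : ∃ a₀, κ a₀ = y ∧ bad a₀
  · obtain ⟨a₀, rfl, hbad⟩ := hy
    refine le_trans (le_of_eq ?_) (hfib a₀ hbad)
    rw [Finset.filter_filter]
    simp only [and_comm, bad]
  · rw [Finset.filter_filter, Finset.filter_false_of_mem]
    · simp only [Finset.card_empty, Nat.cast_zero]
      positivity
    · rintro a _ ⟨h1, h2⟩
      exact hy ⟨a, h2, h1⟩

end Fibers

/-! ### Vertices of low degree: probability estimates -/

section Sizes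

variable {n r : ℕ}

theorem choose_mul_eq_real (hr : 1 ≤ r) (hn : 1 ≤ n) :
    (n.choose r : ℝ) * r = n * (n - 1).choose (r - 1) := by
  exact_mod_cast choose_mul_eq hr hn

theorem codegree_mul_le (hr : 2 ≤ r) (hrn : r ≤ n) :
    ((n - 2).choose (r - 2) : ℝ) * n ≤ (n - 1).choose (r - 1) * r := by
  have h := choose_mul_eq_real (n := n - 1) (r := r - 1) (by omega) (by omega)
  rw [Nat.sub_sub, Nat.sub_sub, Nat.cast_sub (by omega : 1 ≤ n),
    Nat.cast_sub (by omega : 1 ≤ r)] at h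
  push_cast at h
  have h1 : (r : ℝ) ≤ n := by exact_mod_cast hrn
  have h2 : (2 : ℝ) ≤ r := by exact_mod_cast hr
  have h3 : (0 : ℝ) ≤ (n - 1).choose (r - 1) := by positivity
  have h4 : (0 : ℝ) < (n : ℝ) - 1 := by linarith
  refine le_of_mul_le_mul_right ?_ h4
  calc _ = ((n : ℝ) - 1) * ((n - 2).choose (r - 2)) * n := by ring
    _ = (n - 1).choose (r - 1) * ((r - 1) * n) := by rw [← h]; ring
    _ ≤ (n - 1).choose (r - 1) * (r * (n - 1)) :=
        mul_le_mul_of_nonneg_left (by linarith) h3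
    _ = _ := by ring

theorem le_degree_mul (hr : 2 ≤ r) (hrn : r ≤ n) :
    (n : ℝ) ≤ (n - 1).choose (r - 1) * r := by
  have h := choose_mul_eq (n := n - 1) (r := r - 1) (by omega) (by omega)
  have h1 : 1 ≤ (n - 1 - 1).choose (r - 1 - 1) := Nat.choose_pos (by omega)
  have h2 : 1 ≤ (n - 1).choose (r - 1) := Nat.choose_pos (by omega)
  obtain ⟨r, rfl⟩ := Nat.exists_eq_add_of_le' (by omega : 1 ≤ r)
  have h3 : n - 1 ≤ (n - 1).choose (r + 1 - 1) * (r + 1 - 1) := by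
    rw [h]; exact Nat.le_mul_of_pos_right _ h1
  have h4 : n ≤ (n - 1).choose (r + 1 - 1) * (r + 1) := by
    simp only [Nat.add_sub_cancel] at *
    rw [mul_add]; omega
  exact_mod_cast h4

theorem sq_le_choose_mul (hr : 2 ≤ r) (hrn : r ≤ n) :
    (n : ℝ) ^ 2 ≤ n.choose r * (r : ℝ) ^ 2 := by
  calc (n : ℝ) ^ 2 = n * n := sq _
    _ ≤ n * ((n - 1).choose (r - 1) * r) := by gcongr; exact le_degree_mul hr hrn
    _ = _ := by
      rw [← mul_assoc, ← choose_mul_eq_real (by omega) (by omega)]; ring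

/-- A time slightly before the hitting time. -/
noncomputable def lowerTime (r n : ℕ) : ℕ :=
  ⌊(n : ℝ) / r * (Real.log n - √(Real.log n))⌋₊

theorem le_lowerTime (r n : ℕ) :
    (n : ℝ) / r * (Real.log n - √(Real.log n)) - 1 ≤ lowerTime r n :=
  (Nat.sub_one_lt_floor _).le

/-- A time well after the hitting time. -/
noncomputable def upperTime (r n : ℕ) : ℕ := ⌈2 * ((n : ℝ) / r * Real.log n)⌉₊

/-- The bound below which a degree at time `lowerTime r n` is regarded as low. -/
noncomputable def lowDegree (ε : ℝ) (n : ℕ) : ℕ := ⌈ε * Real.log n⌉₊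

/-- `n` is large enough, in terms of `r`, for the estimates below. The constants are generous; the
value `121 = 11 ^ 2` makes `√(log n)` at most `log n / 11`. -/
structure IsLarge (r n : ℕ) : Prop where
  three_le : 3 ≤ r
  log_ge : 121 ≤ Real.log n
  log_sq_le : 400 * (r : ℝ) ^ 2 * Real.log n ^ 2 ≤ n

theorem eventually_isLarge (hr : 3 ≤ r) : ∀ᶠ n in atTop, IsLarge r n := by
  have h1 : ∀ᶠ n : ℕ in atTop, 121 ≤ Real.log n :=
    (Real.tendsto_log_atTop.comp tendsto_natCast_atTop_atTop).eventually_ge_atTop 121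
  have h2 : ∀ᶠ n : ℕ in atTop, ‖Real.log n ^ 2‖ ≤ 1 / (400 * (r : ℝ) ^ 2) * ‖(n : ℝ)‖ := by
    have := (Real.isLittleO_pow_log_id_atTop (n := 2)).comp_tendsto tendsto_natCast_atTop_atTop
    exact this.bound (by positivity)
  filter_upwards [h1, h2] with n h1 h2
  refine ⟨hr, h1, ?_⟩
  rw [Real.norm_of_nonneg (by positivity), Real.norm_of_nonneg (by positivity),
    div_mul_eq_mul_div, one_mul, le_div_iff₀ (by positivity)] at h2
  linarith

namespace IsLarge

variable (h : IsLarge r n)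
include h

theorem sqrt_log_ge : 11 ≤ √(Real.log n) :=
  Real.le_sqrt_of_sq_le (by linarith [h.log_ge])

theorem sqrt_log_le : √(Real.log n) ≤ Real.log n / 11 := by
  have h1 := h.sqrt_log_ge
  have h2 : √(Real.log n) * √(Real.log n) = Real.log n :=
    Real.mul_self_sqrt (by linarith [h.log_ge])
  nlinarith

theorem three_le_real : (3 : ℝ) ≤ r := by exact_mod_cast h.three_le

theorem log_mul_le : 400 * (r : ℝ) ^ 2 * Real.log n ≤ n := by
  refine le_trans ?_ h.log_sq_le
  have := h.log_ge
  gcongr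
  nlinarith

theorem le_real : 400 * (r : ℝ) ^ 2 ≤ n := by
  refine le_trans ?_ h.log_mul_le
  have := h.log_ge
  exact le_mul_of_one_le_right (by positivity) (by linarith)

theorem pos : (0 : ℝ) < n := lt_of_lt_of_le (by have := h.three_le_real; positivity) h.le_real

theorem le_nat : 400 * r ^ 2 ≤ n := by exact_mod_cast h.le_real

theorem mul_le_nat : 400 * r ≤ n := by
  have := h.le_nat
  have := h.three_le
  nlinarith

theorem r_le : r ≤ n := by have := h.mul_le_nat; omega

theorem choose_ge : 12 * ((n - 1).choose (r - 1) : ℝ) ≤ n.choose r := by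
  have h1 := choose_mul_eq_real (n := n) (r := r) (by linarith [h.three_le])
    (by linarith [h.three_le, h.r_le])
  have h2 : (12 * r : ℝ) ≤ n := by
    have : (400 * r : ℝ) ≤ n := by exact_mod_cast h.mul_le_nat
    linarith [h.three_le_real]
  have h3 := h.three_le_real
  refine le_of_mul_le_mul_right ?_ (by linarith : (0 : ℝ) < r)
  rw [h1]
  calc _ = (12 * r : ℝ) * (n - 1).choose (r - 1) := by ring
    _ ≤ _ := by gcongr

theorem one_le_degree : (1 : ℝ) ≤ (n - 1).choose (r - 1) := by
  have : 1 ≤ (n - 1).choose (r - 1) := Nat.choose_pos (by have := h.r_le; omega)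
  exact_mod_cast this

theorem choose_pos : (0 : ℝ) < n.choose r := by linarith [h.choose_ge, h.one_le_degree]

theorem mul_log_le : 400 * (n * Real.log n) ≤ n.choose r := by
  have h1 := sq_le_choose_mul (n := n) (r := r) (by linarith [h.three_le]) h.r_le
  have h3 := h.three_le_real
  have h4 := h.log_mul_le
  have h5 := h.pos
  refine le_of_mul_le_mul_right (le_trans ?_ h1) (by positivity : (0 : ℝ) < (r : ℝ) ^ 2)
  nlinarith

theorem lowerTime_le : (lowerTime r n : ℝ) ≤ n / r * (Real.log n - √(Real.log n)) := by
  refine Nat.floor_le ?_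
  have h1 := h.log_ge
  have h2 := h.sqrt_log_le
  exact mul_nonneg (by positivity) (by linarith)

theorem lowerTime_le' : (lowerTime r n : ℝ) ≤ n * Real.log n := by
  refine h.lowerTime_le.trans ?_
  have h1 := h.log_ge
  have h2 := h.sqrt_log_ge
  have h3 := h.sqrt_log_le
  gcongr
  · linarith
  · exact div_le_self h.pos.le (by linarith [h.three_le_real])
  · linarith

theorem upperTime_le : (upperTime r n : ℝ) ≤ n * Real.log n := by
  have h0 : 0 ≤ 2 * ((n : ℝ) / r * Real.log n) := by
    have := h.log_ge
    positivity
  refine (Nat.ceil_lt_add_one h0).le.trans ?_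
  have h1 := h.log_ge
  have h2 := h.pos
  have h3 : (n : ℝ) / r ≤ n / 3 := by gcongr; exact h.three_le_real
  have h4 : (1 : ℝ) ≤ n := by
    have := h.le_real
    have := h.three_le_real
    nlinarith
  have h5 : (n : ℝ) / r * Real.log n ≤ n / 3 * Real.log n := by gcongr
  nlinarith

theorem lowerTime_le_upperTime : lowerTime r n ≤ upperTime r n := by
  have h1 := h.lowerTime_le
  have h2 : 2 * ((n : ℝ) / r * Real.log n) ≤ upperTime r n := Nat.le_ceil _
  have h3 := h.log_ge
  have h4 := h.sqrt_log_ge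
  have h5 : (n : ℝ) / r * (Real.log n - √(Real.log n)) ≤ n / r * Real.log n := by
    gcongr; linarith
  have h6 : 0 ≤ (n : ℝ) / r * Real.log n := by positivity
  exact_mod_cast (by linarith : (lowerTime r n : ℝ) ≤ upperTime r n)

/-- The expected degree of a vertex at time `lowerTime r n` is at most `log n - √(log n)`; the
number of all edges is multiplied out. -/
theorem lowerTime_mul_degree_le :
    (lowerTime r n : ℝ) * (n - 1).choose (r - 1)
      ≤ n.choose r * (Real.log n - √(Real.log n)) := by
  have h1 := choose_mul_eq_real (n := n) (r := r) (by linarith [h.three_le])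
    (by linarith [h.three_le, h.r_le])
  have h3 := h.three_le_real
  have h4 := h.pos
  calc _ ≤ (n / r * (Real.log n - √(Real.log n))) * (n - 1).choose (r - 1) := by
        gcongr; exact h.lowerTime_le
    _ = (n * (n - 1).choose (r - 1)) / r * (Real.log n - √(Real.log n)) := by ring
    _ = _ := by rw [← h1]; field_simp

theorem le_lowerTime_mul_degree :
    n.choose r * (Real.log n - √(Real.log n) - r / n)
      ≤ (lowerTime r n : ℝ) * (n - 1).choose (r - 1) := by
  have h1 := choose_mul_eq_real (n := n) (r := r) (by linarith [h.three_le])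
    (by linarith [h.three_le, h.r_le])
  have h3 := h.three_le_real
  have h4 := h.pos
  calc _ = (n.choose r * r) / r * (Real.log n - √(Real.log n) - r / n) := by field_simp
    _ = (n / r * (Real.log n - √(Real.log n)) - 1) * (n - 1).choose (r - 1) := by
      rw [h1]; field_simp
    _ ≤ _ := by gcongr; exact le_lowerTime r n

theorem le_upperTime_mul_degree :
    n.choose r * (2 * Real.log n) ≤ (upperTime r n : ℝ) * (n - 1).choose (r - 1) := by
  have h1 := choose_mul_eq_real (n := n) (r := r) (by linarith [h.three_le])
    (by linarith [h.three_le, h.r_le])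
  have h3 := h.three_le_real
  have h4 := h.pos
  calc _ = (n.choose r * r) / r * (2 * Real.log n) := by field_simp
    _ = 2 * (n / r * Real.log n) * (n - 1).choose (r - 1) := by
      rw [h1]; field_simp
    _ ≤ _ := by gcongr; exact Nat.le_ceil _

end IsLarge

/-- An upper bound for the probability that a given edge comes before `upperTime r n`. -/
noncomputable def edgeProb (r n : ℕ) : ℝ := 2 * (n * Real.log n) / n.choose r

theorem degree_mul_edgeProb (h : IsLarge r n) :
    (n - 1).choose (r - 1) * edgeProb r n = 2 * r * Real.log n := by
  have h1 := choose_mul_eq_real (n := n) (r := r) (by linarith [h.three_le])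
    (by linarith [h.three_le, h.r_le])
  have h3 := h.choose_pos
  rw [edgeProb, mul_div_assoc', div_eq_iff h3.ne']
  calc _ = 2 * Real.log n * (n * (n - 1).choose (r - 1)) := by ring
    _ = _ := by rw [← h1]; ring

theorem edgeProb_nonneg (h : IsLarge r n) : 0 ≤ edgeProb r n := by
  have := h.log_ge
  unfold edgeProb
  positivity

theorem card_biUnion_star_ge (hr : 2 ≤ r) {X : Finset (Fin n)} (hX1 : 1 ≤ X.card)
    (hX2 : X.card ≤ 2) :
    X.card * (n - 1).choose (r - 1) ≤ (X.biUnion (star r)).card + (n - 2).choose (r - 2) := by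
  obtain hX | hX : X.card = 1 ∨ X.card = 2 := by omega
  · obtain ⟨x, rfl⟩ := Finset.card_eq_one.1 hX
    simp [card_star (by omega : 1 ≤ r)]
  · obtain ⟨x, y, hxy, rfl⟩ := Finset.card_eq_two.1 hX
    rw [hX, Finset.biUnion_insert, Finset.singleton_biUnion, ← card_star_inter hr hxy,
      Finset.card_union_add_card_inter, card_star (by omega), card_star (by omega), two_mul]

set_option maxHeartbeats 400000 in
/-- The main estimate: one or two given vertices have low degree and at most four given edges come
before `upperTime r n`. A vertex has low degree with probability at most `n ^ (-3/4)`; any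
exponent below `-1/2` would do. -/
theorem unifProb_low_le (h : IsLarge r n) {ε : ℝ} (hε0 : 0 < ε) (hε : ε < 1 / 100)
    (X : Finset (Fin n)) (F : RGraph n r) (hX1 : 1 ≤ X.card) (hX2 : X.card ≤ 2)
    (hF : F.card ≤ 4) :
    unifProb Finset.univ (fun a : EdgeOrdering n r =>
        (∀ x ∈ X, x ∈ lowSet a (lowerTime r n) (lowDegree ε n)) ∧
          ∀ e ∈ F, e ∈ graphAt a (upperTime r n))
      ≤ edgeProb r n ^ F.card * Real.exp (-(3 / 4 * (X.card * Real.log n))) := by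
  set N : ℝ := ((n.choose r : ℕ) : ℝ) with hN
  set D : ℝ := (((n - 1).choose (r - 1) : ℕ) : ℝ) with hD
  set D₂ : ℝ := (((n - 2).choose (r - 2) : ℕ) : ℝ) with hD₂
  set L := Real.log n with hL
  set M₀ := lowerTime r n
  set M₁ := upperTime r n
  set s := lowDegree ε n - 1
  set Z := (X.biUnion (star r)) \ F with hZ
  have hr3 := h.three_le
  have hNpos : 0 < N := h.choose_pos
  have hL0 : 121 ≤ L := h.log_ge
  have hN12 : 12 * D ≤ N := h.choose_ge
  have hD1 : 1 ≤ D := h.one_le_degree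
  have hX1' : (1 : ℝ) ≤ X.card := by exact_mod_cast hX1
  have hX2' : (X.card : ℝ) ≤ 2 := by exact_mod_cast hX2
  have hF' : (F.card : ℝ) ≤ 4 := by exact_mod_cast hF
  have hZle : (Z.card : ℝ) ≤ 2 * D := by
    have h1 : Z.card ≤ X.card * (n - 1).choose (r - 1) :=
      (Finset.card_le_card Finset.sdiff_subset).trans
        (Finset.card_biUnion_le_card_mul _ _ _ fun x _ => (card_star (by omega) x).le)
    have h2 : (Z.card : ℝ) ≤ X.card * D := by rw [hD]; exact_mod_cast h1
    nlinarith
  have hZge : X.card * D - D₂ - 4 ≤ (Z.card : ℝ) := by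
    have h1 := card_biUnion_star_ge (n := n) (r := r) (by omega) hX1 hX2
    have h2 := Finset.le_card_sdiff F (X.biUnion (star r))
    rw [← hZ] at h2
    have h3 : X.card * (n - 1).choose (r - 1) ≤ Z.card + 4 + (n - 2).choose (r - 2) := by omega
    have h4 : X.card * D ≤ (Z.card : ℝ) + 4 + D₂ := by
      rw [hD, hD₂]; exact_mod_cast h3
    linarith
  have hM₀N : 400 * (M₀ : ℝ) ≤ N := by
    have h1 := h.lowerTime_le'
    have h2 := h.mul_log_le
    linarith
  have hkN : ((Z.card + F.card : ℕ) : ℝ) ≤ N / 2 := by push_cast; linarith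
  have h0 := unifProb_low_degree_le (r := r) M₀ M₁ s (Z.card + F.card) X F
    (by
      have : (Z.card : ℝ) + M₀ ≤ n.choose r := by linarith
      exact_mod_cast this) le_rfl
    (by
      have : ((Z.card + F.card : ℕ) : ℝ) < n.choose r := by linarith
      exact_mod_cast this) (ρ := 1 / 16) (by norm_num) (by norm_num)
  refine le_trans ?_ (h0.trans ?_)
  · refine unifProb_mono _ fun a _ ha => ⟨fun x hx => ?_, fun e he => mem_graphAt.1 (ha.2 e he)⟩
    have := mem_lowSet.1 (ha.1 x hx)
    simp only [s]; omega
  rw [← hN]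
  set k : ℝ := ((Z.card + F.card : ℕ) : ℝ)
  have hNk : N / 2 ≤ N - k := by linarith
  have hNk0 : 0 < N - k := by linarith
  have e1 : (M₁ : ℝ) / (N - k) ≤ edgeProb r n := by
    have h2 : edgeProb r n = n * L / (N / 2) := by
      rw [edgeProb, ← hN, ← hL]; field_simp
    rw [h2]
    have h1 := h.upperTime_le
    gcongr
  set q := (M₀ : ℝ) / N with hq
  have hq0 : 0 ≤ q := by positivity
  have hq1 : q ≤ 1 := by
    rw [hq, div_le_one hNpos]
    have : (0 : ℝ) ≤ M₀ := by positivity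
    linarith
  have e2 : (M₀ : ℝ) / (N - k) ≤ 2 * q := by
    have h2 : 2 * q = M₀ / (N / 2) := by rw [hq]; field_simp
    rw [h2]
    gcongr
  have e3 : 1 - q + 1 / 16 * (M₀ / (N - k)) ≤ Real.exp (-(7 / 8 * q)) := by
    have := Real.add_one_le_exp (-(7 / 8 * q))
    linarith
  have e4 : 0 ≤ 1 - q + 1 / 16 * (M₀ / (N - k)) := by
    have : (0 : ℝ) ≤ M₀ / (N - k) := by positivity
    linarith
  have hs : (s : ℝ) ≤ ε * L := by
    have h1 : (lowDegree ε n : ℝ) < ε * L + 1 := Nat.ceil_lt_add_one (by positivity)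
    by_cases hd : lowDegree ε n = 0
    · simp only [s, hd]; simp; positivity
    · simp only [s]
      rw [Nat.cast_sub (by omega)]
      push_cast; linarith
  have e5 : (((1 : ℝ) / 16) ^ (X.card * s))⁻¹ ≤ Real.exp (3 / 100 * (X.card * L)) := by
    rw [one_div, inv_pow, inv_inv]
    have h1 : (16 : ℝ) ≤ Real.exp 3 := by
      have h2 := Real.exp_one_gt_d9
      have h3 : Real.exp 3 = Real.exp 1 ^ 3 := by rw [← Real.exp_nat_mul]; norm_num
      rw [h3]
      calc (16 : ℝ) ≤ 2.6 ^ 3 := by norm_num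
        _ ≤ _ := by gcongr; linarith
    calc (16 : ℝ) ^ (X.card * s) ≤ Real.exp 3 ^ (X.card * s) := by gcongr
      _ = Real.exp ((X.card * s : ℕ) * 3) := by rw [← Real.exp_nat_mul]
      _ ≤ _ := by
        rw [Real.exp_le_exp]
        push_cast
        have : (s : ℝ) ≤ 1 / 100 * L := hs.trans (by gcongr)
        nlinarith
  -- the expected number of early edges at the vertices of `X`
  have hqD : L - √L - r / n ≤ q * D := by
    rw [hq, div_mul_eq_mul_div, le_div_iff₀ hNpos, mul_comm]
    exact h.le_lowerTime_mul_degree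
  have hqD' : q * D ≤ L := by
    rw [hq, div_mul_eq_mul_div, div_le_iff₀ hNpos, mul_comm L]
    refine h.lowerTime_mul_degree_le.trans ?_
    gcongr
    linarith [h.sqrt_log_ge]
  have hnpos := h.pos
  have hqD₂ : q * D₂ ≤ 1 / 100 := by
    have h1 : D₂ * n ≤ D * r := codegree_mul_le (by omega) h.r_le
    have h2 : q * D₂ * n ≤ L * r := by
      calc q * D₂ * n = q * (D₂ * n) := by ring
        _ ≤ q * (D * r) := by gcongr
        _ = (q * D) * r := by ring
        _ ≤ L * r := by gcongr
    have h3 := h.log_mul_le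
    have h4 : L * r ≤ n / 100 := by
      have h5 := h.three_le_real
      rw [← hL] at h3
      nlinarith [mul_pos (by linarith : (0 : ℝ) < L) (by linarith : (0 : ℝ) < (r : ℝ))]
    rw [← mul_le_mul_iff_left₀ hnpos]
    linarith
  have hq4 : q * 4 ≤ 1 / 100 := by
    have : q ≤ 1 / 400 := by
      rw [hq, div_le_iff₀ hNpos]; linarith
    linarith
  have hrn : (r : ℝ) / n ≤ 1 / 100 := by
    rw [div_le_iff₀ hnpos]
    have : (400 * r : ℝ) ≤ n := by exact_mod_cast h.mul_le_nat
    linarith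
  have hqZ : 9 / 10 * (X.card * L) ≤ q * Z.card := by
    have h1 : q * (X.card * D - D₂ - 4) ≤ q * Z.card := by gcongr
    have h2 : X.card * (L - L / 11 - 1 / 100) ≤ X.card * (q * D) := by
      gcongr
      have := h.sqrt_log_le
      linarith
    have h3 : (X.card : ℝ) * 121 ≤ X.card * L := by gcongr
    linarith
  calc _ ≤ Real.exp (3 / 100 * (X.card * L)) * edgeProb r n ^ F.card
        * Real.exp (-(7 / 8 * q)) ^ Z.card := by
        have := edgeProb_nonneg h
        gcongr
    _ = edgeProb r n ^ F.card * (Real.exp (3 / 100 * (X.card * L))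
        * Real.exp (-(7 / 8 * q)) ^ Z.card) := by ring
    _ ≤ _ := by
        refine mul_le_mul_of_nonneg_left ?_ (pow_nonneg (edgeProb_nonneg h) _)
        rw [← Real.exp_nat_mul, ← Real.exp_add, Real.exp_le_exp]
        have : 0 ≤ X.card * L := by positivity
        linarith

end Sizes

/-! ### Sparsity holds with high probability -/

section Sparse

variable {n r : ℕ}

/-- Two distinct vertices of low degree are joined by a chain of `k + 1` distinct edges of
`H_{M₁}`. -/
def HasChain (a : EdgeOrdering n r) (M d M₁ k : ℕ) : Prop :=
  ∃ x ∈ (Finset.univ : Finset (Fin n)), ∃ l ∈ chains r x k,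
    ∃ y ∈ l.head?.elim ∅ (fun e => e.1), (x ≠ y ∧ l.Nodup) ∧
      (∀ z ∈ ({x, y} : Finset (Fin n)), z ∈ lowSet a M d) ∧ ∀ e ∈ l.toFinset, e ∈ graphAt a M₁

/-- Two distinct edges of `H_{M₁}` have a common vertex outside an edge `A` of `H_{M₁}` which
contains a vertex of low degree, and both meet `A`. -/
def HasFork (a : EdgeOrdering n r) (M d M₁ : ℕ) : Prop :=
  ∃ x ∈ (Finset.univ : Finset (Fin n)), ∃ A ∈ star r x, ∃ v ∈ A.1ᶜ,
    ∃ e ∈ star r v ∩ meeting r A.1, ∃ f ∈ star r v ∩ meeting r A.1, e ≠ f ∧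
      (∀ z ∈ ({x} : Finset (Fin n)), z ∈ lowSet a M d) ∧
        ∀ g ∈ ({A, e, f} : RGraph n r), g ∈ graphAt a M₁

theorem isSparse_of_not_hasChain {a : EdgeOrdering n r} {M d w M₁ : ℕ} (hM : M ≤ M₁)
    (hcov : ∀ v, ∃ A ∈ graphAt a M₁, v ∈ A.1) (hw : (lowSet a M d).card ≤ w)
    (hchain : ∀ k ∈ Finset.Icc 1 3, ¬ HasChain a M d M₁ k) (hfork : ¬ HasFork a M d M₁) :
    IsSparse a M d w := by
  classical
  have hmono : ∀ g ∈ graphAt a M, g ∈ graphAt a M₁ := fun g hg =>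
    mem_graphAt.2 ((mem_graphAt.1 hg).trans_le hM)
  have hfirst : ∀ e ∈ firstEdges a M d, ∃ x ∈ lowSet a M d, IsFirstEdge a x e ∧
      e ∈ graphAt a M₁ := by
    intro e he
    obtain ⟨x, hx, hxe⟩ := mem_firstEdges.1 he
    exact ⟨x, hx, hxe, hxe.mem_graphAt (hcov x)⟩
  have hdisj : ∀ e ∈ firstEdges a M d, ∀ f ∈ firstEdges a M d, e ≠ f →
      Disjoint e.1 f.1 := by
    intro e he f hf hef
    by_contra hmeet
    obtain ⟨x, hx, hxe, he₁⟩ := hfirst e he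
    obtain ⟨y, hy, hyf, hf₁⟩ := hfirst f hf
    have hxy : x ≠ y := fun h => hef (hxe.unique (h ▸ hyf))
    refine hchain 1 (by simp) ⟨x, Finset.mem_univ _, [f, e],
      cons_mem_chains (singleton_mem_chains hxe.1) fun h => hmeet h.symm, y, hyf.1,
      ⟨hxy, by simp [hef.symm]⟩, by simp [hx, hy], ?_⟩
    intro g hg
    simp only [List.mem_toFinset, List.mem_cons, List.not_mem_nil, or_false] at hg
    rcases hg with rfl | rfl <;> assumption
  refine ⟨hw, hdisj, ?_, ?_⟩
  · intro g hg e he f hf hef hge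
    by_contra hgf
    obtain ⟨x, hx, hxe, he₁⟩ := hfirst e he
    obtain ⟨y, hy, hyf, hf₁⟩ := hfirst f hf
    have hxy : x ≠ y := fun h => hef (hxe.unique (h ▸ hyf))
    have hgne : g ≠ e := by rintro rfl; exact hgf (hdisj g he f hf hef)
    have hgnf : f ≠ g := by rintro rfl; exact hge (hdisj f hf e he hef.symm)
    have hg₁ := hmono g hg
    refine hchain 2 (by simp) ⟨x, Finset.mem_univ _, [f, g, e],
      cons_mem_chains (cons_mem_chains (singleton_mem_chains hxe.1) hge) fun h => hgf h.symm,
      y, hyf.1, ⟨hxy, by simp [hef.symm, hgne, hgnf]⟩, by simp [hx, hy], ?_⟩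
    intro g' hg'
    simp only [List.mem_toFinset, List.mem_cons, List.not_mem_nil, or_false] at hg'
    rcases hg' with rfl | rfl | rfl <;> assumption
  · intro v hv g₁ hg₁ g₂ hg₂ hv₁ hv₂ hU₁ hU₂
    by_contra hne
    have hnear : ∀ g : Edge n r, g ∈ meeting r (absorbed a M d) →
        ∃ e ∈ firstEdges a M d, ¬ Disjoint g.1 e.1 := by
      intro g hg
      obtain ⟨u, hu, huU⟩ := Finset.not_disjoint_iff.1 (mem_meeting.1 hg)
      obtain ⟨e, he, hue⟩ := mem_absorbed.1 huU
      exact ⟨e, he, Finset.not_disjoint_iff.2 ⟨u, hu, hue⟩⟩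
    have hvout : ∀ e ∈ firstEdges a M d, v ∉ e.1 := fun e he hve =>
      hv (mem_absorbed.2 ⟨e, he, hve⟩)
    obtain ⟨e, he, hge⟩ := hnear g₁ hU₁
    obtain ⟨f, hf, hgf⟩ := hnear g₂ hU₂
    obtain ⟨x, hx, hxe, he₁⟩ := hfirst e he
    obtain ⟨y, hy, hyf, hf₁⟩ := hfirst f hf
    have hg₁' := hmono g₁ hg₁
    have hg₂' := hmono g₂ hg₂
    by_cases hef : e = f
    · subst hef
      refine hfork ⟨x, Finset.mem_univ _, e, mem_star.2 hxe.1, v, by simpa using hvout e he,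
        g₁, by simp [hv₁, hge], g₂, by simp [hv₂, hgf], hne, by simpa using hx, ?_⟩
      intro g hg
      simp only [Finset.mem_insert, Finset.mem_singleton] at hg
      rcases hg with rfl | rfl | rfl <;> assumption
    · have hxy : x ≠ y := fun h => hef (hxe.unique (h ▸ hyf))
      have hne' : ∀ g : Edge n r, v ∈ g.1 → ∀ e ∈ firstEdges a M d, g ≠ e := by
        rintro g hg e he rfl
        exact hvout g he hg
      refine hchain 3 (by simp) ⟨x, Finset.mem_univ _, [f, g₂, g₁, e],
        cons_mem_chains (cons_mem_chains (cons_mem_chains (singleton_mem_chains hxe.1) hge)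
          (Finset.not_disjoint_iff.2 ⟨v, hv₂, hv₁⟩)) fun h => hgf h.symm,
        y, hyf.1, ⟨hxy, ?_⟩, by simp [hx, hy], ?_⟩
      · simp [Ne.symm hef, (hne' g₂ hv₂ f hf).symm, (hne' g₁ hv₁ f hf).symm, Ne.symm hne,
          hne' g₂ hv₂ e he, hne' g₁ hv₁ e he]
      · intro g hg
        simp only [List.mem_toFinset, List.mem_cons, List.not_mem_nil, or_false] at hg
        rcases hg with rfl | rfl | rfl | rfl <;> assumption

theorem unifProb_const_and_le {Ω : Type} (S : Finset Ω) {c : Prop} {p : Ω → Prop} {b : ℝ}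
    (hb : 0 ≤ b) (h : c → unifProb S p ≤ b) : unifProb S (fun ω => c ∧ p ω) ≤ b := by
  classical
  by_cases hc : c
  · simpa [hc] using h hc
  · simpa [hc, unifProb] using hb

variable {ε : ℝ}

theorem unifProb_hasChain_le (h : IsLarge r n) (hε0 : 0 < ε) (hε : ε < 1 / 100) {k : ℕ}
    (hk : k ≤ 3) :
    unifProb Finset.univ (fun a : EdgeOrdering n r =>
        HasChain a (lowerTime r n) (lowDegree ε n) (upperTime r n) k)
      ≤ r * (2 * (r : ℝ) ^ 2 * Real.log n) ^ (k + 1) * Real.exp (-(1 / 2 * Real.log n)) := by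
  have hr := h.three_le
  have hp := edgeProb_nonneg h
  set b : ℝ := edgeProb r n ^ (k + 1) * Real.exp (-(3 / 4 * (2 * Real.log n))) with hb
  have hb0 : 0 ≤ b := by positivity
  have h1 : unifProb Finset.univ (fun a : EdgeOrdering n r =>
        HasChain a (lowerTime r n) (lowDegree ε n) (upperTime r n) k)
      ≤ n * (((r * (n - 1).choose (r - 1) : ℕ) : ℝ) ^ (k + 1) * (r * b)) := by
    refine (unifProb_exists_le_card_mul _ _ _ fun x _ => ?_).trans_eq (by rw [Finset.card_fin])
    refine (unifProb_exists_le_card_mul _ _ _ (c := r * b) fun l hl => ?_).trans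
      (mul_le_mul_of_nonneg_right (by exact_mod_cast card_chains_le (by omega) x k)
        (by positivity))
    refine (unifProb_exists_le_card_mul _ _ _ (c := b) fun y hy => ?_).trans
      (mul_le_mul_of_nonneg_right ?_ hb0)
    · refine unifProb_const_and_le _ hb0 fun ⟨hxy, hnd⟩ => ?_
      have hc : l.toFinset.card = k + 1 := by
        rw [List.toFinset_card_of_nodup hnd, length_of_mem_chains hl]
      have h2 := unifProb_low_le h hε0 hε {x, y} l.toFinset (by rw [Finset.card_pair hxy]; simp)
        (by rw [Finset.card_pair hxy]) (by omega)
      rw [hc, Finset.card_pair hxy] at h2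
      exact_mod_cast h2
    · rcases l with _ | ⟨e, l⟩
      · simp
      · simp [e.2]
  refine h1.trans_eq ?_
  have h3 := degree_mul_edgeProb h
  have h4 : (n : ℝ) * Real.exp (-(3 / 4 * (2 * Real.log n)))
      = Real.exp (-(1 / 2 * Real.log n)) := by
    nth_rewrite 1 [← Real.exp_log h.pos]
    rw [← Real.exp_add]
    congr 1; ring
  have h5 : 2 * (r : ℝ) ^ 2 * Real.log n = r * ((n - 1).choose (r - 1) * edgeProb r n) := by
    rw [h3]; ring
  rw [hb, ← h4, h5]
  push_cast
  ring

theorem unifProb_hasFork_le (h : IsLarge r n) (hε0 : 0 < ε) (hε : ε < 1 / 100) :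
    unifProb Finset.univ (fun a : EdgeOrdering n r =>
        HasFork a (lowerTime r n) (lowDegree ε n) (upperTime r n))
      ≤ (r : ℝ) ^ 4 * (2 * r * Real.log n) ^ 3 * Real.exp (-(3 / 4 * Real.log n)) := by
  have hr := h.three_le
  have hp := edgeProb_nonneg h
  set b : ℝ := edgeProb r n ^ 3 * Real.exp (-(3 / 4 * Real.log n)) with hb
  have hb0 : 0 ≤ b := by positivity
  set C : ℝ := ((r * (n - 2).choose (r - 2) : ℕ) : ℝ) with hC
  have hC0 : 0 ≤ C := by positivity
  have h1 : unifProb Finset.univ (fun a : EdgeOrdering n r =>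
        HasFork a (lowerTime r n) (lowDegree ε n) (upperTime r n))
      ≤ n * ((n - 1).choose (r - 1) * (n * (C * (C * b)))) := by
    refine (unifProb_exists_le_card_mul _ _ _ fun x _ => ?_).trans_eq (by rw [Finset.card_fin])
    refine (unifProb_exists_le_card_mul _ _ _ fun A hA => ?_).trans_eq
      (by rw [card_star (by omega)])
    refine (unifProb_exists_le_card_mul _ _ _ (c := C * (C * b)) fun v hv => ?_).trans
      (mul_le_mul_of_nonneg_right ?_ (by positivity))
    · have hCle : ((star r v ∩ meeting r A.1).card : ℝ) ≤ C := by
        have := card_star_inter_meeting_le (r := r) (by omega) (Finset.mem_compl.1 hv)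
        rw [A.2] at this
        rw [hC]
        exact_mod_cast this
      refine (unifProb_exists_le_card_mul _ _ _ (c := C * b) fun e he => ?_).trans
        (mul_le_mul_of_nonneg_right hCle (by positivity))
      refine (unifProb_exists_le_card_mul _ _ _ (c := b) fun f hf => ?_).trans
        (mul_le_mul_of_nonneg_right hCle hb0)
      refine unifProb_const_and_le _ hb0 fun hef => ?_
      have hne : ∀ g ∈ star r v ∩ meeting r A.1, A ≠ g := by
        rintro g hg rfl
        exact Finset.mem_compl.1 hv (mem_star.1 (Finset.mem_inter.1 hg).1)
      have hc : ({A, e, f} : RGraph n r).card = 3 :=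
        Finset.card_eq_three.2 ⟨A, e, f, hne e he, hne f hf, hef, rfl⟩
      have h2 := unifProb_low_le h hε0 hε {x} {A, e, f} (by simp) (by simp) (by omega)
      rw [hc, Finset.card_singleton, Nat.cast_one, one_mul] at h2
      exact h2
    · exact_mod_cast (Finset.card_le_univ _).trans (by simp)
  refine h1.trans ?_
  have h3 := degree_mul_edgeProb h
  have h4 := codegree_mul_le (n := n) (r := r) (by omega) h.r_le
  have h5 : C * n ≤ r ^ 2 * (n - 1).choose (r - 1) := by
    rw [hC]; push_cast
    calc _ = (r : ℝ) * ((n - 2).choose (r - 2) * n) := by ring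
      _ ≤ r * ((n - 1).choose (r - 1) * r) := by gcongr
      _ = _ := by ring
  calc _ = (C * n) ^ 2 * ((n - 1).choose (r - 1) * b) := by ring
    _ ≤ (r ^ 2 * (n - 1).choose (r - 1)) ^ 2 * ((n - 1).choose (r - 1) * b) := by gcongr
    _ = (r : ℝ) ^ 4 * ((n - 1).choose (r - 1) * edgeProb r n) ^ 3
          * Real.exp (-(3 / 4 * Real.log n)) := by rw [hb]; ring
    _ = _ := by rw [h3]

theorem unifProb_many_low_le (h : IsLarge r n) (hε0 : 0 < ε) (hε : ε < 1 / 100) :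
    unifProb Finset.univ (fun a : EdgeOrdering n r =>
        ¬ (lowSet a (lowerTime r n) (lowDegree ε n)).card ≤ Nat.sqrt n)
      ≤ Real.exp (-(1 / 4 * Real.log n)) := by
  classical
  have hn := h.pos
  have h1 := unifProb_card_filter_gt_le (Finset.univ : Finset (EdgeOrdering n r))
    (Finset.univ : Finset (Fin n)) (fun x a => x ∈ lowSet a (lowerTime r n) (lowDegree ε n))
    (Real.sqrt_pos.2 hn)
  have h2 : ∑ x ∈ (Finset.univ : Finset (Fin n)), unifProb Finset.univ (fun a : EdgeOrdering n r =>
      x ∈ lowSet a (lowerTime r n) (lowDegree ε n)) ≤ n * Real.exp (-(3 / 4 * Real.log n)) := by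
    refine (Finset.sum_le_card_nsmul _ _ (Real.exp (-(3 / 4 * Real.log n))) fun x _ => ?_).trans_eq
      (by simp)
    have := unifProb_low_le h hε0 hε {x} ∅ (by simp) (by simp) (by simp)
    simpa using this
  refine (unifProb_mono _ fun a _ ha => ?_).trans (h1.trans ?_)
  · rw [Finset.filter_mem_eq_inter, Finset.univ_inter]
    rw [not_le, Nat.sqrt_lt'] at ha
    rw [Real.sqrt_lt' (by
      have : 0 < (lowSet a (lowerTime r n) (lowDegree ε n)).card := by
        by_contra h0
        simp only [not_lt, nonpos_iff_eq_zero] at h0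
        rw [h0] at ha; simp at ha
      exact_mod_cast this)]
    exact_mod_cast ha
  · rw [div_le_iff₀ (Real.sqrt_pos.2 hn)]
    refine h2.trans_eq ?_
    have h3 : √(n : ℝ) = Real.exp (1 / 2 * Real.log n) := by
      rw [Real.sqrt_eq_rpow, Real.rpow_def_of_pos hn, mul_comm]
    rw [h3, ← Real.exp_add]
    nth_rewrite 1 [← Real.exp_log hn]
    rw [← Real.exp_add]
    congr 1; ring

theorem unifProb_not_covered_le (h : IsLarge r n) :
    unifProb Finset.univ (fun a : EdgeOrdering n r =>
        ¬ ∀ v, ∃ A ∈ graphAt a (upperTime r n), v ∈ A.1) ≤ Real.exp (-Real.log n) := by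
  have hr := h.three_le
  have hN := h.choose_pos
  have h1 : ∀ v ∈ (Finset.univ : Finset (Fin n)), unifProb Finset.univ
      (fun a : EdgeOrdering n r => ∀ e ∈ star r v, e ∉ graphAt a (upperTime r n))
      ≤ Real.exp (-(2 * Real.log n)) := by
    intro v _
    have hcard : ((star r v).card : ℝ) = (n - 1).choose (r - 1) := by
      rw [card_star (by omega)]
    have hle : (star r v).card + upperTime r n ≤ n.choose r := by
      have h2 := h.upperTime_le
      have h3 := h.mul_log_le
      have h4 := h.choose_ge
      have h5 : ((star r v).card : ℝ) + upperTime r n ≤ n.choose r := by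
        rw [hcard]; linarith
      exact_mod_cast h5
    rw [unifProb_isolated_eq _ _ hle]
    refine (prod_avoid_le _ _ _ hle).trans ?_
    have h2 : 1 - (upperTime r n : ℝ) / n.choose r
        ≤ Real.exp (-((upperTime r n : ℝ) / n.choose r)) := by
      have := Real.add_one_le_exp (-((upperTime r n : ℝ) / n.choose r))
      linarith
    have h3 : 0 ≤ 1 - (upperTime r n : ℝ) / n.choose r := by
      rw [sub_nonneg, div_le_one hN]
      exact_mod_cast (by omega : upperTime r n ≤ n.choose r)
    calc _ ≤ Real.exp (-((upperTime r n : ℝ) / n.choose r)) ^ (star r v).card := by gcongr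
      _ ≤ _ := by
        rw [← Real.exp_nat_mul, Real.exp_le_exp, hcard, mul_neg, neg_le_neg_iff, mul_div_assoc',
          le_div_iff₀ hN, mul_comm, mul_comm ((n - 1).choose (r - 1) : ℝ)]
        exact h.le_upperTime_mul_degree
  refine (unifProb_mono _ fun a _ ha => ?_).trans
    ((unifProb_exists_le_card_mul _ _ _ h1).trans_eq ?_)
  · push Not at ha
    obtain ⟨v, hv⟩ := ha
    exact ⟨v, Finset.mem_univ _, fun e he he' => hv e he' (mem_star.1 he)⟩
  · rw [Finset.card_fin]
    nth_rewrite 1 [← Real.exp_log h.pos]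
    rw [← Real.exp_add]
    congr 1; ring

theorem tendsto_pow_log_mul_exp (k : ℕ) {c : ℝ} (hc : 0 < c) (C : ℝ) :
    Tendsto (fun n : ℕ => C * Real.log n ^ k * Real.exp (-(c * Real.log n))) atTop (𝓝 0) := by
  have h1 := (Real.tendsto_pow_mul_exp_neg_atTop_nhds_zero k).comp
    ((Real.tendsto_log_atTop.comp tendsto_natCast_atTop_atTop).const_mul_atTop hc)
  have h2 := h1.const_mul (C / c ^ k)
  rw [mul_zero] at h2
  refine h2.congr fun n => ?_
  simp only [Function.comp]
  field_simp
  ring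

/-- With high probability the vertices of low degree are few and far apart. -/
theorem tendsto_unifProb_not_isSparse (hr : 3 ≤ r) (hε0 : 0 < ε) (hε : ε < 1 / 100) :
    Tendsto (fun n => unifProb Finset.univ (fun a : EdgeOrdering n r =>
      ¬ IsSparse a (lowerTime r n) (lowDegree ε n) (Nat.sqrt n))) atTop (𝓝 0) := by
  have hc : ∀ k : ℕ, Tendsto (fun n : ℕ =>
      r * (2 * (r : ℝ) ^ 2 * Real.log n) ^ (k + 1) * Real.exp (-(1 / 2 * Real.log n)))
      atTop (𝓝 0) := by
    intro k
    refine (tendsto_pow_log_mul_exp (k + 1) (c := 1 / 2) (by norm_num)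
      (r * (2 * (r : ℝ) ^ 2) ^ (k + 1))).congr fun n => ?_
    rw [mul_pow (2 * (r : ℝ) ^ 2)]; ring
  have hf : Tendsto (fun n : ℕ =>
      (r : ℝ) ^ 4 * (2 * r * Real.log n) ^ 3 * Real.exp (-(3 / 4 * Real.log n)))
      atTop (𝓝 0) := by
    refine (tendsto_pow_log_mul_exp 3 (c := 3 / 4) (by norm_num)
      ((r : ℝ) ^ 4 * (2 * r) ^ 3)).congr fun n => ?_
    ring
  have hl : Tendsto (fun n : ℕ => Real.exp (-(1 / 4 * Real.log n))) atTop (𝓝 0) := by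
    simpa using tendsto_pow_log_mul_exp 0 (c := 1 / 4) (by norm_num) 1
  have hu : Tendsto (fun n : ℕ => Real.exp (-Real.log n)) atTop (𝓝 0) := by
    simpa using tendsto_pow_log_mul_exp 0 (c := 1) (by norm_num) 1
  have hsum := ((hu.add hl).add (tendsto_finsetSum (Finset.Icc 1 3) fun k _ => hc k)).add hf
  simp only [Finset.sum_const_zero, add_zero] at hsum
  refine squeeze_zero' (Eventually.of_forall fun n => unifProb_nonneg _ _) ?_ hsum
  filter_upwards [eventually_isLarge hr] with n h
  refine (unifProb_mono _ (q := fun a : EdgeOrdering n r =>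
    (((¬ ∀ v, ∃ A ∈ graphAt a (upperTime r n), v ∈ A.1) ∨
      ¬ (lowSet a (lowerTime r n) (lowDegree ε n)).card ≤ Nat.sqrt n) ∨
      ∃ k ∈ Finset.Icc 1 3, HasChain a (lowerTime r n) (lowDegree ε n) (upperTime r n) k) ∨
      HasFork a (lowerTime r n) (lowDegree ε n) (upperTime r n)) fun a _ ha => ?_).trans ?_
  · by_contra hcon
    push Not at hcon
    exact ha (isSparse_of_not_hasChain h.lowerTime_le_upperTime hcon.1.1.1 hcon.1.1.2
      hcon.1.2 hcon.2)
  · refine (unifProb_or_le _ _ _).trans (add_le_add ?_ (unifProb_hasFork_le h hε0 hε))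
    refine (unifProb_or_le _ _ _).trans (add_le_add ?_ ?_)
    · exact (unifProb_or_le _ _ _).trans
        (add_le_add (unifProb_not_covered_le h) (unifProb_many_low_le h hε0 hε))
    · refine (unifProb_exists_le _ _ _).trans (Finset.sum_le_sum fun k hk => ?_)
      exact unifProb_hasChain_le h hε0 hε (Finset.mem_Icc.1 hk).2

end Sparse

/-! ### Isolated vertices shortly before the hitting time -/

section SecondMoment

variable {n r : ℕ}

theorem le_hittingTime_of_isolated (hr : 1 ≤ r) (hrn : r ≤ n) {a : EdgeOrdering n r} {M : ℕ}
    {v : Fin n} (hv : ∀ e ∈ star r v, e ∉ graphAt a M) : M ≤ hittingTime a := by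
  obtain ⟨A, hA, hvA⟩ := hittingTime_spec hr hrn a v
  by_contra hlt
  exact hv A (mem_star.2 hvA) (mem_graphAt.2 ((mem_graphAt.1 hA).trans (not_le.1 hlt)))

/-- A product over two overlapping stars is compared with the square of the product over one. -/
theorem prod_range_mul_pow_le {f : ℕ → ℝ} {D c : ℕ} (hcD : c ≤ D)
    (hf0 : ∀ i < 2 * D, 0 ≤ f i) (hf : ∀ i j, i ≤ j → j < 2 * D → f j ≤ f i) {b : ℝ}
    (hb0 : 0 ≤ b) (hb : ∀ i < D, b ≤ f i) :
    (∏ i ∈ Finset.range (2 * D - c), f i) * b ^ c ≤ (∏ i ∈ Finset.range D, f i) ^ 2 := by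
  have h1 : 2 * D - c = D + (D - c) := by omega
  have h2 : ∏ i ∈ Finset.range D, f i
      = (∏ i ∈ Finset.range (D - c), f i) * ∏ i ∈ Finset.range c, f (D - c + i) := by
    rw [← Finset.prod_range_add, Nat.sub_add_cancel hcD]
  have h3 : ∏ i ∈ Finset.range (D - c), f (D + i) ≤ ∏ i ∈ Finset.range (D - c), f i := by
    refine Finset.prod_le_prod (fun i hi => hf0 _ ?_) fun i hi => hf _ _ (by omega) ?_ <;>
    · have := Finset.mem_range.1 hi; omega
  have h4 : b ^ c ≤ ∏ i ∈ Finset.range c, f (D - c + i) := by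
    rw [← Finset.card_range c, ← Finset.prod_const, Finset.card_range]
    refine Finset.prod_le_prod (fun _ _ => hb0) fun i hi => hb _ ?_
    have := Finset.mem_range.1 hi; omega
  have h5 : 0 ≤ ∏ i ∈ Finset.range D, f i :=
    Finset.prod_nonneg fun i hi => hf0 _ (by have := Finset.mem_range.1 hi; omega)
  have h6 : 0 ≤ ∏ i ∈ Finset.range (D - c), f i :=
    Finset.prod_nonneg fun i hi => hf0 _ (by have := Finset.mem_range.1 hi; omega)
  rw [h1, Finset.prod_range_add]
  calc _ ≤ (∏ i ∈ Finset.range D, f i) * (∏ i ∈ Finset.range (D - c), f i) *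
        ∏ i ∈ Finset.range c, f (D - c + i) := by gcongr
    _ = _ := by rw [mul_assoc, ← h2, sq]

/-- The probability that a given vertex is isolated at time `lowerTime r n`. -/
noncomputable def isolatedProb (r n : ℕ) : ℝ :=
  ∏ i ∈ Finset.range ((n - 1).choose (r - 1)),
    (((n.choose r : ℝ) - lowerTime r n - i) / (n.choose r - i))

theorem lowerTime_div_le (h : IsLarge r n) :
    (lowerTime r n : ℝ) / (n.choose r - (n - 1).choose (r - 1)) ≤ 1 / 300 := by
  have h1 := h.lowerTime_le'
  have h2 := h.mul_log_le
  have h3 := h.choose_ge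
  have h4 := h.one_le_degree
  rw [div_le_iff₀ (by linarith)]
  linarith

theorem one_sub_le_div (h : IsLarge r n) {i : ℕ} (hi : i < (n - 1).choose (r - 1)) :
    1 - (lowerTime r n : ℝ) / (n.choose r - (n - 1).choose (r - 1))
      ≤ ((n.choose r : ℝ) - lowerTime r n - i) / (n.choose r - i) := by
  have h3 := h.choose_ge
  have h4 := h.one_le_degree
  have h5 : (i : ℝ) < (n - 1).choose (r - 1) := by exact_mod_cast hi
  have h6 : (0 : ℝ) < n.choose r - i := by linarith
  have h7 : (0 : ℝ) < n.choose r - (n - 1).choose (r - 1) := by linarith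
  have : ((n.choose r : ℝ) - lowerTime r n - i) / (n.choose r - i)
      = 1 - lowerTime r n / (n.choose r - i) := by
    field_simp; ring
  rw [this]
  gcongr

theorem le_mul_isolatedProb (h : IsLarge r n) :
    Real.exp (√(Real.log n) - 1) ≤ n * isolatedProb r n := by
  have hN := h.choose_pos
  have hN12 := h.choose_ge
  have hD1 := h.one_le_degree
  have hMN : 400 * (lowerTime r n : ℝ) ≤ n.choose r := by
    have h1 := h.lowerTime_le'
    have h2 := h.mul_log_le
    linarith
  have hu := lowerTime_div_le h
  have hMD := h.lowerTime_mul_degree_le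
  set N : ℝ := ((n.choose r : ℕ) : ℝ) with hNdef
  set D : ℝ := (((n - 1).choose (r - 1) : ℕ) : ℝ) with hD
  set M : ℝ := (lowerTime r n : ℝ) with hM
  set L := Real.log n with hL
  have hM0 : 0 ≤ M := by positivity
  set u := M / (N - D) with hudef
  have hND : 0 < N - D := by linarith
  have hNDM : 0 < N - D - M := by linarith
  have hu1 : 0 < 1 - u := by linarith
  have h1 : (1 - u) ^ (n - 1).choose (r - 1) ≤ isolatedProb r n := by
    rw [isolatedProb]
    nth_rewrite 1 [← Finset.card_range ((n - 1).choose (r - 1))]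
    rw [← Finset.prod_const]
    exact Finset.prod_le_prod (fun _ _ => hu1.le) fun i hi =>
      one_sub_le_div h (Finset.mem_range.1 hi)
  have h2 : Real.exp (-(M / (N - D - M))) ≤ 1 - u := by
    rw [← Real.le_log_iff_exp_le hu1]
    refine le_trans (le_of_eq ?_) (Real.one_sub_inv_le_log_of_pos hu1)
    have : 1 - u = (N - D - M) / (N - D) := by rw [hudef]; field_simp
    rw [this, inv_div]
    field_simp; ring
  have h3 : D * (M / (N - D - M)) ≤ L - √L + 1 := by
    rw [mul_div_assoc', div_le_iff₀ hNDM]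
    -- `L (D + M) / N` is small
    have h4 : L * D ≤ N / 4 := by
      have h5 := choose_mul_eq_real (n := n) (r := r) (by linarith [h.three_le])
        (by linarith [h.three_le, h.r_le])
      have h6 := h.log_mul_le
      have h7 := h.three_le_real
      refine le_of_mul_le_mul_right ?_ (by linarith : (0 : ℝ) < r)
      have h8 : L * r * D ≤ n / 4 * D := by
        gcongr
        have := h.log_ge
        nlinarith [mul_pos (by linarith : (0 : ℝ) < L) (by linarith : (0 : ℝ) < (r : ℝ))]
      rw [← hNdef, ← hD] at h5
      linarith
    have h5 : L * M ≤ N / 4 := by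
      have h6 := h.lowerTime_le'
      have h7 := sq_le_choose_mul (n := n) (r := r) (by linarith [h.three_le]) h.r_le
      have h8 := h.log_sq_le
      have h9 := h.three_le_real
      have h10 := h.log_ge
      refine le_of_mul_le_mul_right ?_ (by positivity : (0 : ℝ) < (r : ℝ) ^ 2)
      have h11 : L * M * (r : ℝ) ^ 2 ≤ L * (n * L) * (r : ℝ) ^ 2 := by gcongr
      have h12 : n * (400 * (r : ℝ) ^ 2 * L ^ 2) ≤ (n : ℝ) * n := by gcongr
      rw [← hNdef] at h7
      have h13 : 0 ≤ (n : ℝ) * ((r : ℝ) ^ 2 * L ^ 2) := by positivity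
      nlinarith
    have h6 := h.sqrt_log_ge
    have h7 := h.sqrt_log_le
    rw [← hL] at h6 h7
    have h8 : √L * (D + M) ≥ 0 := by positivity
    nlinarith
  have hn := h.pos
  calc _ ≤ Real.exp (L + D * -(M / (N - D - M))) := by
        rw [Real.exp_le_exp]; linarith
    _ = n * Real.exp (-(M / (N - D - M))) ^ (n - 1).choose (r - 1) := by
        rw [Real.exp_add, hL, Real.exp_log hn, ← Real.exp_nat_mul]
    _ ≤ n * (1 - u) ^ (n - 1).choose (r - 1) := by gcongr
    _ ≤ _ := by gcongr

theorem isolatedProb_pos (h : IsLarge r n) : 0 < isolatedProb r n := by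
  have h1 := le_mul_isolatedProb h
  have h2 := Real.exp_pos (√(Real.log n) - 1)
  exact pos_of_mul_pos_right (h2.trans_le h1) h.pos.le

theorem unifProb_isolated (h : IsLarge r n) (x : Fin n) :
    unifProb Finset.univ (fun a : EdgeOrdering n r =>
      ∀ e ∈ star r x, e ∉ graphAt a (lowerTime r n)) = isolatedProb r n := by
  have hr := h.three_le
  have hcard : (star r x).card = (n - 1).choose (r - 1) := card_star (by omega) x
  rw [unifProb_isolated_eq, hcard, isolatedProb]
  rw [hcard]
  have h1 := h.lowerTime_le'
  have h2 := h.mul_log_le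
  have h3 := h.choose_ge
  have : ((n - 1).choose (r - 1) : ℝ) + lowerTime r n ≤ n.choose r := by linarith
  exact_mod_cast this

/-- Two vertices are both isolated with probability at most `1 + o(1)` times the square of the
probability for one: their stars share only a proportion `O(1 / n)` of their edges. -/
theorem unifProb_two_isolated_le (h : IsLarge r n) {x y : Fin n} (hxy : x ≠ y) :
    unifProb Finset.univ (fun a : EdgeOrdering n r =>
      (∀ e ∈ star r x, e ∉ graphAt a (lowerTime r n)) ∧
        ∀ e ∈ star r y, e ∉ graphAt a (lowerTime r n)) * (1 - 4 * r * (Real.log n / n))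
      ≤ isolatedProb r n ^ 2 := by
  classical
  have hr := h.three_le
  set D := (n - 1).choose (r - 1) with hD
  set c := (n - 2).choose (r - 2) with hc
  set M := lowerTime r n with hM
  have hMN : 400 * (M : ℝ) ≤ n.choose r := by
    have h1 := h.lowerTime_le'
    have h2 := h.mul_log_le
    linarith
  have hN12 : 12 * (D : ℝ) ≤ n.choose r := h.choose_ge
  have hD1 : 1 ≤ (D : ℝ) := h.one_le_degree
  have hnpos := h.pos
  have hcod : (c : ℝ) * n ≤ D * r := codegree_mul_le (by omega) h.r_le
  have hcard : (star r x ∪ star r y).card = 2 * D - c := by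
    have h1 := Finset.card_union_add_card_inter (star r x) (star r y)
    rw [card_star_inter (by omega) hxy, card_star (by omega), card_star (by omega)] at h1
    omega
  have hcD : c ≤ D := by
    rw [hc, hD, ← card_star_inter (by omega) hxy, ← card_star (by omega) x]
    exact Finset.card_le_card Finset.inter_subset_left
  have h1 : unifProb Finset.univ (fun a : EdgeOrdering n r =>
      (∀ e ∈ star r x, e ∉ graphAt a M) ∧ ∀ e ∈ star r y, e ∉ graphAt a M)
      = ∏ i ∈ Finset.range (2 * D - c), (((n.choose r : ℝ) - M - i) / (n.choose r - i)) := by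
    rw [← hcard, ← unifProb_isolated_eq]
    · congr 1
      funext a
      simp only [Finset.mem_union, or_imp, forall_and]
    · rw [hcard]
      have : (2 * D + M : ℝ) ≤ n.choose r := by linarith
      have : 2 * D + M ≤ n.choose r := by exact_mod_cast this
      omega
  rw [h1]
  set u : ℝ := (M : ℝ) / (n.choose r - D) with hu
  have hu1 : u ≤ 1 / 300 := lowerTime_div_le h
  have hu0 : 0 ≤ u := div_nonneg (by positivity) (by linarith)
  have hlt : ∀ i < 2 * D, (0 : ℝ) < n.choose r - i ∧ (0 : ℝ) ≤ n.choose r - M - i := by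
    intro i hi
    have : (i : ℝ) < 2 * D := by exact_mod_cast hi
    exact ⟨by linarith, by linarith⟩
  have h2 : (∏ i ∈ Finset.range (2 * D - c), (((n.choose r : ℝ) - M - i) / (n.choose r - i)))
      * (1 - u) ^ c ≤ isolatedProb r n ^ 2 := by
    refine prod_range_mul_pow_le hcD (fun i hi => div_nonneg (hlt i hi).2 (hlt i hi).1.le) ?_
      (by linarith) fun i hi => one_sub_le_div h hi
    intro i j hij hj
    have hj1 := (hlt j hj).1
    have hi1 := (hlt i (by omega)).1
    have hij' : (i : ℝ) ≤ j := by exact_mod_cast hij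
    rw [div_le_div_iff₀ hj1 hi1]
    have hM0 : (0 : ℝ) ≤ M := by positivity
    nlinarith
  have h3 : 1 - 4 * r * (Real.log n / n) ≤ (1 - u) ^ c := by
    have h4 := one_add_mul_le_pow (a := -u) (by linarith) c
    rw [← sub_eq_add_neg] at h4
    refine le_trans ?_ h4
    have h5 : (M : ℝ) * D ≤ n.choose r * Real.log n := by
      refine h.lowerTime_mul_degree_le.trans ?_
      gcongr
      linarith [h.sqrt_log_ge]
    have h6 : c * u ≤ 4 * r * (Real.log n / n) := by
      have hND : (0 : ℝ) < n.choose r - D := by linarith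
      rw [hu, mul_div_assoc', mul_div_assoc', div_le_div_iff₀ hND hnpos]
      have hL := h.log_ge
      calc (c * M : ℝ) * n = M * (c * n) := by ring
        _ ≤ M * (D * r) := by gcongr
        _ = (M * D) * r := by ring
        _ ≤ (n.choose r * Real.log n) * r := by gcongr
        _ ≤ (4 * (n.choose r - D) * Real.log n) * r := by gcongr; linarith
        _ = _ := by ring
    linarith
  refine le_trans ?_ h2
  refine mul_le_mul_of_nonneg_left h3 (Finset.prod_nonneg fun i hi => ?_)
  have := hlt i (by have := Finset.mem_range.1 hi; omega)
  exact div_nonneg this.2 this.1.le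

theorem le_unifProb_exists_isolated (h : IsLarge r n) :
    (Real.exp (-(√(Real.log n) - 1)) + (1 - 4 * r * (Real.log n / n))⁻¹)⁻¹
      ≤ unifProb Finset.univ (fun a : EdgeOrdering n r =>
        ∃ x ∈ (Finset.univ : Finset (Fin n)), ∀ e ∈ star r x, e ∉ graphAt a (lowerTime r n)) := by
  classical
  have hn := h.pos
  have hp := isolatedProb_pos h
  have hL := h.log_ge
  set p := isolatedProb r n with hpdef
  have hη : 0 < 1 - 4 * r * (Real.log n / n) := by
    have h1 := h.log_mul_le
    have h2 := h.three_le_real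
    rw [sub_pos, mul_div_assoc', div_lt_one hn]
    nlinarith [mul_pos (by linarith : (0 : ℝ) < Real.log n) (by linarith : (0 : ℝ) < (r : ℝ))]
  set η := 1 - 4 * r * (Real.log n / n) with hηdef
  have h1 := sq_sum_unifProb_le (Finset.univ : Finset (EdgeOrdering n r))
    (Finset.univ : Finset (Fin n)) (fun x a => ∀ e ∈ star r x, e ∉ graphAt a (lowerTime r n))
  set P := unifProb Finset.univ (fun a : EdgeOrdering n r =>
        ∃ x ∈ (Finset.univ : Finset (Fin n)), ∀ e ∈ star r x, e ∉ graphAt a (lowerTime r n))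
  have hP : 0 ≤ P := unifProb_nonneg _ _
  simp only [unifProb_isolated h, Finset.sum_const, Finset.card_fin, nsmul_eq_mul] at h1
  rw [← hpdef] at h1
  have h2 : ∑ x : Fin n, ∑ y : Fin n, unifProb Finset.univ (fun a : EdgeOrdering n r =>
      (∀ e ∈ star r x, e ∉ graphAt a (lowerTime r n)) ∧
        ∀ e ∈ star r y, e ∉ graphAt a (lowerTime r n)) ≤ n * (p + n * (p ^ 2 * η⁻¹)) := by
    have h3 : ∀ x y : Fin n, unifProb Finset.univ (fun a : EdgeOrdering n r =>
      (∀ e ∈ star r x, e ∉ graphAt a (lowerTime r n)) ∧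
        ∀ e ∈ star r y, e ∉ graphAt a (lowerTime r n))
        ≤ (if x = y then p else 0) + p ^ 2 * η⁻¹ := by
      intro x y
      split_ifs with hxy
      · subst hxy
        simp only [and_self]
        rw [unifProb_isolated h]
        have : 0 ≤ p ^ 2 * η⁻¹ := by positivity
        linarith
      · rw [zero_add, ← div_eq_mul_inv, le_div_iff₀ hη]
        exact unifProb_two_isolated_le h hxy
    refine (Finset.sum_le_sum fun x _ => Finset.sum_le_sum fun y _ => h3 x y).trans_eq ?_
    simp [Finset.sum_add_distrib]
    ring
  have hμ := le_mul_isolatedProb h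
  rw [← hpdef] at hμ
  have hμ0 : 0 < n * p := by positivity
  have h4 : (n * p) ^ 2 ≤ (n * p) ^ 2 * ((n * p)⁻¹ + η⁻¹) * P := by
    refine h1.trans ((mul_le_mul_of_nonneg_right h2 hP).trans_eq ?_)
    field_simp
  have h5 : 1 ≤ ((n * p)⁻¹ + η⁻¹) * P := by
    rw [mul_assoc] at h4
    exact le_of_mul_le_mul_left (by linarith) (by positivity : 0 < (n * p) ^ 2)
  have h6 : (n * p)⁻¹ ≤ Real.exp (-(√(Real.log n) - 1)) := by
    rw [Real.exp_neg]
    exact inv_anti₀ (Real.exp_pos _) hμ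
  rw [inv_le_iff_one_le_mul₀' (by positivity)]
  exact h5.trans (by gcongr)

/-- With high probability there is an isolated vertex at time `lowerTime r n`, so that the hitting
time comes later. -/
theorem tendsto_unifProb_hittingTime_lt (hr : 3 ≤ r) :
    Tendsto (fun n => unifProb Finset.univ (fun a : EdgeOrdering n r =>
      ¬ lowerTime r n ≤ hittingTime a)) atTop (𝓝 0) := by
  have hlog : Tendsto (fun n : ℕ => Real.log n) atTop atTop :=
    Real.tendsto_log_atTop.comp tendsto_natCast_atTop_atTop
  have h1 : Tendsto (fun n : ℕ => Real.exp (-(√(Real.log n) - 1))) atTop (𝓝 0) := by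
    refine Real.tendsto_exp_neg_atTop_nhds_zero.comp ?_
    exact tendsto_atTop_add_const_right _ _ (Real.tendsto_sqrt_atTop.comp hlog)
  have h2 : Tendsto (fun n : ℕ => Real.log n / n) atTop (𝓝 0) := by
    have := (Real.isLittleO_log_id_atTop.tendsto_div_nhds_zero).comp tendsto_natCast_atTop_atTop
    exact this
  have h3 : Tendsto (fun n : ℕ =>
      (Real.exp (-(√(Real.log n) - 1)) + (1 - 4 * r * (Real.log n / n))⁻¹)⁻¹) atTop (𝓝 1) := by
    have h4 : Tendsto (fun n : ℕ => 1 - 4 * (r : ℝ) * (Real.log n / n)) atTop (𝓝 1) := by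
      simpa using (h2.const_mul (4 * (r : ℝ))).const_sub 1
    simpa using (h1.add (h4.inv₀ one_ne_zero)).inv₀ (by norm_num)
  have h5 := h3.const_sub 1
  rw [sub_self] at h5
  refine squeeze_zero' (Eventually.of_forall fun n => unifProb_nonneg _ _) ?_ h5
  filter_upwards [eventually_isLarge hr] with n h
  have h6 := le_unifProb_exists_isolated h
  have h7 := unifProb_add_not (Finset.univ_nonempty (α := EdgeOrdering n r))
    (fun a => lowerTime r n ≤ hittingTime a)
  have h8 : unifProb Finset.univ (fun a : EdgeOrdering n r =>
      ∃ x ∈ (Finset.univ : Finset (Fin n)), ∀ e ∈ star r x, e ∉ graphAt a (lowerTime r n))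
      ≤ unifProb Finset.univ (fun a : EdgeOrdering n r => lowerTime r n ≤ hittingTime a) := by
    refine unifProb_mono _ fun a _ ⟨x, _, hx⟩ => ?_
    exact le_hittingTime_of_isolated (by omega) h.r_le hx
  linarith

end SecondMoment

/-! ### Passage to the induced graph and conclusion -/

section Conclusion

variable {n r : ℕ}

/-- The largest value of `|ϱ m|` for `n / 2 ≤ m ≤ n`. -/
noncomputable def maxAbs (ϱ : ℕ → ℝ) (n : ℕ) : ℝ :=
  (Finset.Icc (n / 2) n).sup' (Finset.nonempty_Icc.2 (Nat.div_le_self n 2)) fun m => |ϱ m|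

theorem le_maxAbs (ϱ : ℕ → ℝ) {m : ℕ} (h1 : n ≤ 2 * m) (h2 : m ≤ n) : |ϱ m| ≤ maxAbs ϱ n :=
  Finset.le_sup' (fun m => |ϱ m|) (Finset.mem_Icc.2 ⟨by omega, h2⟩)

theorem maxAbs_nonneg (ϱ : ℕ → ℝ) (n : ℕ) : 0 ≤ maxAbs ϱ n :=
  (abs_nonneg _).trans (le_maxAbs ϱ (by omega : n ≤ 2 * n) le_rfl)

theorem tendsto_maxAbs {ϱ : ℕ → ℝ} (h : Tendsto ϱ atTop (𝓝 0)) :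
    Tendsto (maxAbs ϱ) atTop (𝓝 0) := by
  rw [Metric.tendsto_atTop] at h ⊢
  intro η hη
  obtain ⟨m₀, hm₀⟩ := h η hη
  refine ⟨2 * m₀, fun n hn => ?_⟩
  rw [Real.dist_eq, sub_zero, abs_of_nonneg (maxAbs_nonneg ϱ n), maxAbs, Finset.sup'_lt_iff]
  intro m hm
  have := hm₀ m (by have := (Finset.mem_Icc.1 hm).1; omega)
  simpa [Real.dist_eq] using this

/-- The error term of the counting result for `H_T`. -/
noncomputable def countError (ϱ : ℕ → ℝ) (n : ℕ) : ℝ :=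
  maxAbs ϱ n + Real.log n / √n + 2 / Real.log n

theorem tendsto_countError {ϱ : ℕ → ℝ} (h : Tendsto ϱ atTop (𝓝 0)) :
    Tendsto (countError ϱ) atTop (𝓝 0) := by
  have hlog : Tendsto (fun n : ℕ => Real.log n) atTop atTop :=
    Real.tendsto_log_atTop.comp tendsto_natCast_atTop_atTop
  have h1 : Tendsto (fun n : ℕ => Real.log n / √n) atTop (𝓝 0) := by
    have h2 := (isLittleO_log_rpow_atTop (r := 1 / 2) (by norm_num)).tendsto_div_nhds_zero.comp
      tendsto_natCast_atTop_atTop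
    refine h2.congr fun n => ?_
    simp [Function.comp, Real.sqrt_eq_rpow]
  have h2 : Tendsto (fun n : ℕ => 2 / Real.log n) atTop (𝓝 0) := hlog.const_div_atTop 2
  have h3 := ((tendsto_maxAbs h).add h1).add h2
  simp only [add_zero] at h3
  exact h3

/-- The number `m = n - k r` of vertices left after deleting `k ≤ √n` disjoint edges is close
to `n`. -/
theorem reduced_size_bounds (h : IsLarge r n) {m k : ℕ} (hk : k ≤ Nat.sqrt n)
    (hm : m + k * r = n) :
    19 / 20 * (n : ℝ) ≤ m ∧ Real.log n - 1 ≤ Real.log m ∧ Real.log m ≤ Real.log n := by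
  have hn := h.pos
  have hr := h.three_le_real
  have hm' : (m : ℝ) + k * r = n := by exact_mod_cast hm
  have hk' : (k : ℝ) ≤ √n := by
    refine Real.le_sqrt_of_sq_le ?_
    exact_mod_cast Nat.le_sqrt'.1 hk
  have hs : 20 * (r : ℝ) ≤ √n := by
    refine Real.le_sqrt_of_sq_le ?_
    have := h.le_real
    nlinarith
  have hss : √(n : ℝ) * √n = n := Real.mul_self_sqrt hn.le
  have hkr : 20 * ((k : ℝ) * r) ≤ n := by
    rw [← hss]
    calc 20 * ((k : ℝ) * r) = k * (20 * r) := by ring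
      _ ≤ √n * √n := by gcongr
  have h1 : 19 / 20 * (n : ℝ) ≤ m := by linarith
  have hmpos : (0 : ℝ) < m := by linarith
  refine ⟨h1, ?_, ?_⟩
  · have h2 := Real.add_one_le_exp 1
    have h3 : (n : ℝ) ≤ m * Real.exp 1 := by nlinarith
    have h4 := Real.log_le_log hn h3
    rw [Real.log_mul hmpos.ne' (Real.exp_pos 1).ne', Real.log_exp] at h4
    linarith
  · refine Real.log_le_log hmpos ?_
    have : 0 ≤ (k : ℝ) * r := by positivity
    linarith

/-- The rate at which the parameters of the induced graph approach their limits. -/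
noncomputable def reducedError (r m : ℕ) : ℝ := 24 * r / √(Real.log m)

theorem tendsto_reducedError (r : ℕ) : Tendsto (reducedError r) atTop (𝓝 0) := by
  have hlog : Tendsto (fun n : ℕ => √(Real.log n)) atTop atTop :=
    Real.tendsto_sqrt_atTop.comp (Real.tendsto_log_atTop.comp tendsto_natCast_atTop_atTop)
  exact hlog.const_div_atTop _

theorem reducedError_mul_log (h : IsLarge r n) {m k : ℕ} (hk : k ≤ Nat.sqrt n)
    (hm : m + k * r = n) :
    12 * r * √(Real.log n) ≤ reducedError r m * Real.log m := by
  obtain ⟨h1, h2, h3⟩ := reduced_size_bounds h hk hm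
  have hL := h.log_ge
  have h4 : √(Real.log n) ≤ 2 * √(Real.log m) := by
    rw [Real.sqrt_le_left (by positivity), mul_pow, Real.sq_sqrt (by linarith)]
    linarith
  have h5 : 0 < √(Real.log m) := Real.sqrt_pos.2 (by linarith)
  have h6 : reducedError r m * Real.log m = 24 * r * √(Real.log m) := by
    rw [reducedError, div_mul_eq_mul_div, mul_div_assoc, Real.div_sqrt]
  rw [h6]
  nlinarith [h.three_le_real]

/-- The induced graph has the number of edges required for conditional counting. -/
theorem abs_edges_sub_le (h : IsLarge r n) {m k M : ℕ} (hk : k ≤ Nat.sqrt n)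
    (hm : m + k * r = n) (hM : M ≤ lowerTime r n) (hM' : lowerTime r n ≤ M + 2 * n) :
    |(M : ℝ) - (m : ℝ) / r * Real.log m| ≤ reducedError r m * ((m : ℝ) / r * Real.log m) := by
  obtain ⟨h1, h2, h3⟩ := reduced_size_bounds h hk hm
  have hn := h.pos
  have hr := h.three_le_real
  have hL := h.log_ge
  have hsL := h.sqrt_log_ge
  have hm' : (m : ℝ) + k * r = n := by exact_mod_cast hm
  have hk' : (k : ℝ) ≤ √n := by
    refine Real.le_sqrt_of_sq_le ?_
    exact_mod_cast Nat.le_sqrt'.1 hk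
  set L := Real.log n
  set L' := Real.log m
  have hs : √L * √L = L := Real.mul_self_sqrt (by linarith)
  have hrhs : 11 * (n * √L) ≤ reducedError r m * ((m : ℝ) / r * L') := by
    have h4 := reducedError_mul_log h hk hm
    calc 11 * (n * √L) ≤ (19 / 20 * n) / r * (12 * r * √L) := by
          have : (19 / 20 * n : ℝ) / r * (12 * r * √L) = 57 / 5 * (n * √L) := by
            field_simp; ring
          rw [this]
          have : 0 ≤ n * √L := by positivity
          linarith
      _ ≤ (m : ℝ) / r * (reducedError r m * L') := by gcongr
      _ = _ := by ring
  refine le_trans ?_ hrhs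
  have h4 : (lowerTime r n : ℝ) ≤ n / r * (L - √L) := h.lowerTime_le
  have h5 : (n : ℝ) / r * (L - √L) - 1 ≤ lowerTime r n := le_lowerTime r n
  have h6 : (M : ℝ) ≤ lowerTime r n := by exact_mod_cast hM
  have h7 : (lowerTime r n : ℝ) ≤ M + 2 * n := by exact_mod_cast hM'
  have hdiff : (n : ℝ) / r * L - m / r * L' = k * L + m / r * (L - L') := by
    rw [← hm']; field_simp; ring
  have hkL : k * L ≤ n * √L := by
    have h8 : √L ≤ √(n : ℝ) :=
      Real.sqrt_le_sqrt ((Real.log_le_sub_one_of_pos hn).trans (by linarith))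
    have h9 : √(n : ℝ) * √n = n := Real.mul_self_sqrt hn.le
    calc k * L ≤ √n * L := by gcongr
      _ = √n * √L * √L := by rw [mul_assoc, hs]
      _ ≤ √n * √n * √L := by gcongr
      _ = _ := by rw [h9]
  have hmr : (m : ℝ) / r * (L - L') ≤ n := by
    have h8 : (m : ℝ) / r ≤ m := div_le_self (by positivity) (by linarith)
    have h9 : (m : ℝ) ≤ n := by
      have : 0 ≤ (k : ℝ) * r := by positivity
      linarith
    calc (m : ℝ) / r * (L - L') ≤ n * 1 := by
          gcongr
          · exact h8.trans h9
          · linarith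
      _ = n := mul_one _
  have hmr0 : 0 ≤ (m : ℝ) / r * (L - L') := mul_nonneg (by positivity) (by linarith)
  have hkL0 : 0 ≤ k * L := by positivity
  have hnr : (n : ℝ) / r * √L ≤ n * √L := by
    gcongr
    exact div_le_self hn.le (by linarith)
  have hnr0 : 0 ≤ (n : ℝ) / r * √L := by positivity
  have hn1 : 1 ≤ (n : ℝ) := by
    have := h.le_real
    nlinarith
  have hns : 11 * (n : ℝ) ≤ n * √L := by nlinarith
  rw [abs_le]
  constructor <;> linarith

/-- The degree bounds in the induced graph are close enough to `ε log m` for conditional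
counting. -/
theorem abs_degree_sub_le (h : IsLarge r n) {ε : ℝ} (hε0 : 0 < ε) (hε1 : ε < 1)
    (hεL : 1 ≤ ε * √(Real.log n)) {m k δ : ℕ} (hk : k ≤ Nat.sqrt n)
    (hm : m + k * r = n) (hδ : δ ≤ lowDegree ε n) (hδ' : lowDegree ε n ≤ δ + 1) :
    |(δ : ℝ) - ε * Real.log m| ≤ reducedError r m * (ε * Real.log m) := by
  obtain ⟨h1, h2, h3⟩ := reduced_size_bounds h hk hm
  have hr := h.three_le_real
  have hL := h.log_ge
  have h4 : ε * Real.log n ≤ lowDegree ε n := Nat.le_ceil _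
  have h5 : (lowDegree ε n : ℝ) < ε * Real.log n + 1 := Nat.ceil_lt_add_one (by positivity)
  have h6 : (δ : ℝ) ≤ lowDegree ε n := by exact_mod_cast hδ
  have h7 : (lowDegree ε n : ℝ) ≤ δ + 1 := by exact_mod_cast hδ'
  have hrhs : 2 ≤ reducedError r m * (ε * Real.log m) := by
    have h8 := reducedError_mul_log h hk hm
    calc (2 : ℝ) ≤ 12 * r * 1 := by linarith
      _ ≤ 12 * r * (ε * √(Real.log n)) := by gcongr
      _ = ε * (12 * r * √(Real.log n)) := by ring
      _ ≤ ε * (reducedError r m * Real.log m) := by gcongr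
      _ = _ := by ring
  refine le_trans ?_ hrhs
  have h9 : ε * (Real.log n - Real.log m) ≤ 1 := by nlinarith
  have h10 : 0 ≤ ε * (Real.log n - Real.log m) := mul_nonneg hε0.le (by linarith)
  rw [abs_le]
  constructor <;> linarith

/-- Passing from `n` to `m` vertices costs a factor `exp (o(n))` in the number of perfect
matchings, absorbed in `countError`. -/
theorem pmBound_le_pmBound (h : IsLarge r n) (ϱ : ℕ → ℝ) {m k : ℕ} (hk : k ≤ Nat.sqrt n)
    (hm : m + k * r = n) :
    pmBound r n (countError ϱ n) ≤ pmBound r m (ϱ m) := by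
  obtain ⟨h1, h2, h3⟩ := reduced_size_bounds h hk hm
  have hn := h.pos
  have hr := h.three_le_real
  have hL := h.log_ge
  have hk' : (k : ℝ) ≤ √n := by
    refine Real.le_sqrt_of_sq_le ?_
    exact_mod_cast Nat.le_sqrt'.1 hk
  have hr0 : 0 < r := by linarith [h.three_le]
  have hdiv : n / r = m / r + k := by
    rw [← hm, Nat.add_mul_div_right _ _ hr0]
  have hmn : m ≤ n := by rw [← hm]; exact Nat.le_add_right _ _
  have hmn' : (m : ℝ) ≤ n := by exact_mod_cast hmn
  have hn2m : n ≤ 2 * m := by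
    have : (n : ℝ) ≤ 2 * m := by linarith
    exact_mod_cast this
  rw [pmBound, pmBound, hdiv, pow_add]
  set L := Real.log n
  set L' := Real.log m
  set c := Real.exp (-((r : ℝ) - 1))
  have hc0 : 0 < c := Real.exp_pos _
  have hc1 : c ≤ 1 := Real.exp_le_one_iff.2 (by linarith)
  have hL'0 : 0 < L' := by linarith
  have e1 : (c * L) ^ k ≤ Real.exp (k * L) := by
    rw [Real.exp_nat_mul]
    gcongr
    have := Real.add_one_le_exp L
    nlinarith
  have e2 : (c * L) ^ (m / r) ≤ (c * L') ^ (m / r) * Real.exp (2 / L * n) := by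
    have h4 : c * L ≤ c * L' * Real.exp (2 / L) := by
      have h5 : L = L' * ((L - L') / L' + 1) := by field_simp; ring
      have h6 : (L - L') / L' ≤ 2 / L := by
        rw [div_le_div_iff₀ hL'0 (by linarith)]
        nlinarith
      have h7 := Real.add_one_le_exp (2 / L)
      rw [mul_assoc]
      gcongr
      calc L = L' * ((L - L') / L' + 1) := h5
        _ ≤ L' * Real.exp (2 / L) := by gcongr; linarith
    calc (c * L) ^ (m / r) ≤ (c * L' * Real.exp (2 / L)) ^ (m / r) := by gcongr
      _ = (c * L') ^ (m / r) * Real.exp ((m / r : ℕ) * (2 / L)) := by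
        rw [mul_pow, ← Real.exp_nat_mul]
      _ ≤ _ := by
        rw [mul_comm (2 / L)]
        gcongr
        exact (Nat.div_le_self m r).trans hmn
  calc _ ≤ (c * L') ^ (m / r) * Real.exp (2 / L * n) * Real.exp (k * L)
        * Real.exp (-(countError ϱ n * n)) := by gcongr
    _ = (c * L') ^ (m / r) * Real.exp (2 / L * n + k * L - countError ϱ n * n) := by
        rw [mul_assoc, mul_assoc, ← Real.exp_add, ← Real.exp_add]
        ring_nf
    _ ≤ _ := by
        gcongr
        have h5 : ϱ m * m ≤ maxAbs ϱ n * n := by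
          calc ϱ m * m ≤ |ϱ m| * m := by gcongr; exact le_abs_self _
            _ ≤ maxAbs ϱ n * n := by
              gcongr
              · exact maxAbs_nonneg _ _
              · exact le_maxAbs ϱ hn2m hmn
        have h6 : k * L ≤ L / √n * n := by
          have h7 : L / √n * n = √n * L := by
            rw [div_mul_eq_mul_div, mul_div_assoc, Real.div_sqrt, mul_comm]
          rw [h7]
          gcongr
        have h8 : countError ϱ n * n = maxAbs ϱ n * n + L / √n * n + 2 / L * n := by
          rw [countError]; ring
        linarith

theorem pmBound_nonneg (r n : ℕ) (ϱ : ℝ) : 0 ≤ pmBound r n ϱ := by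
  unfold pmBound
  have := Real.log_natCast_nonneg n
  positivity

theorem eventually_atTopMultiples {r : ℕ} {p : ℕ → Prop} :
    (∀ᶠ n in atTopMultiples r, p n) ↔ ∃ n₀, ∀ n ≥ n₀, r ∣ n → p n := by
  rw [atTopMultiples, eventually_inf_principal, eventually_atTop]
  rfl

theorem hittingTimeCounting_of_conditionalCounting (hr : 3 ≤ r) {ε : ℝ} (hε0 : 0 < ε)
    (hε : ε < 1 / 100) (hcc : ConditionalCounting r ε) : HittingTimeCounting r := by
  obtain ⟨ϱ, hϱ, hev⟩ := hcc (reducedError r) (tendsto_reducedError r)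
  obtain ⟨m₀, hm₀⟩ := eventually_atTopMultiples.1 hev
  refine ⟨countError ϱ, tendsto_countError hϱ, ?_⟩
  have hsqrt : ∀ᶠ n : ℕ in atTop, 1 ≤ ε * √(Real.log n) :=
    (((Real.tendsto_sqrt_atTop.comp (Real.tendsto_log_atTop.comp
      tendsto_natCast_atTop_atTop)).const_mul_atTop hε0).eventually_ge_atTop 1)
  have hlim := (((tendsto_unifProb_not_isSparse hr hε0 hε).add
    (tendsto_unifProb_hittingTime_lt hr)).add (tendsto_maxAbs hϱ)).const_sub 1
  simp only [add_zero, sub_zero] at hlim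
  refine tendsto_of_tendsto_of_tendsto_of_le_of_le' (hlim.mono_left inf_le_left)
    tendsto_const_nhds ?_ (Eventually.of_forall fun n => unifProb_le_one _ _)
  rw [atTopMultiples, eventually_inf_principal]
  filter_upwards [eventually_isLarge hr, hsqrt, eventually_ge_atTop (2 * m₀)] with n h hsq hn hrn
  have hMN : lowerTime r n ≤ n.choose r := by
    have h1 := h.lowerTime_le'
    have h2 := h.mul_log_le
    have h3 : (lowerTime r n : ℝ) ≤ n.choose r := by
      have : 0 ≤ n * Real.log n := mul_nonneg h.pos.le (by linarith [h.log_ge])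
      linarith
    exact_mod_cast h3
  have hmain := unifProb_sparse_few_PM_le (n := n) (r := r) (M := lowerTime r n)
    (d := lowDegree ε n) (w := Nat.sqrt n) (B := pmBound r n (countError ϱ n))
    (by omega) h.r_le hMN (maxAbs_nonneg ϱ n) (by
      rintro m M δ ⟨k, hk, hm⟩ hM hM' hδ
      have h1 := (reduced_size_bounds h hk hm).1
      have hn2m : n ≤ 2 * m := by
        have h2 := h.pos
        have : (n : ℝ) ≤ 2 * m := by linarith
        exact_mod_cast this
      have hmn : m ≤ n := by rw [← hm]; exact Nat.le_add_right _ _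
      have hrm : r ∣ m := by
        rw [← hm] at hrn
        exact (Nat.dvd_add_left (Dvd.intro_left k rfl)).1 hrn
      have h3 := hm₀ m (by omega) hrm M δ (abs_edges_sub_le h hk hm hM hM')
        (fun x => abs_degree_sub_le h hε0 (by linarith) hsq hk hm (hδ x).1 (hδ x).2)
      refine le_trans ?_ (h3.le.trans ((le_abs_self _).trans (le_maxAbs ϱ hn2m hmn)))
      refine div_le_div_of_nonneg_right (unifProb_mono _ fun H _ hH => ⟨?_, hH.2⟩)
        (unifProb_nonneg _ _)
      exact hH.1.trans (pmBound_le_pmBound h ϱ hk hm))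
  have h1 := unifProb_add_not (Finset.univ_nonempty (α := EdgeOrdering n r))
    (fun a => pmBound r n (countError ϱ n) < (numPM (graphAt a (hittingTime a)) : ℝ))
  have h2 : unifProb Finset.univ (fun a : EdgeOrdering n r =>
      ¬ pmBound r n (countError ϱ n) < (numPM (graphAt a (hittingTime a)) : ℝ))
      ≤ unifProb Finset.univ (fun a : EdgeOrdering n r =>
        (¬ IsSparse a (lowerTime r n) (lowDegree ε n) (Nat.sqrt n) ∨
          ¬ lowerTime r n ≤ hittingTime a) ∨
        (IsSparse a (lowerTime r n) (lowDegree ε n) (Nat.sqrt n) ∧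
          lowerTime r n ≤ hittingTime a ∧
          (numPM (graphAt a (hittingTime a)) : ℝ) ≤ pmBound r n (countError ϱ n))) := by
    refine unifProb_mono _ fun a _ ha => ?_
    rw [not_lt] at ha
    tauto
  have h3 := h2.trans ((unifProb_or_le _ _ _).trans
    (add_le_add (unifProb_or_le _ _ _) hmain))
  linarith

theorem HittingTimeCounting.hittingTimePM (h : HittingTimeCounting r) : HittingTimePM r := by
  classical
  obtain ⟨ϱ, _, h⟩ := h
  refine tendsto_of_tendsto_of_tendsto_of_le_of_le h tendsto_const_nhds
    (fun n => unifProb_mono _ fun a _ ha => ?_) fun n => unifProb_le_one _ _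
  have hpos : 0 < numPM (graphAt a (hittingTime a)) := by
    exact_mod_cast (pmBound_nonneg r n (ϱ n)).trans_lt ha
  obtain ⟨m, hm⟩ := Finset.card_pos.1 hpos
  exact ⟨m, (Finset.mem_filter.1 hm).2⟩

end Conclusion

end Shamir

theorem mainTheorem4 (r : ℕ) (hr : 3 ≤ r) :
    ∃ ε₀ : ℝ, 0 < ε₀ ∧ ∀ ε : ℝ, 0 < ε → ε < ε₀ →
      Shamir.ConditionalCounting r ε →
        Shamir.HittingTimeCounting r ∧ Shamir.HittingTimePM r := by
  refine ⟨1 / 100, by norm_num, fun ε hε0 hε hcc => ?_⟩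
  have h := Shamir.hittingTimeCounting_of_conditionalCounting hr hε0 hε hcc
  exact ⟨h, h.hittingTimePM⟩
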